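/- **Setting.** For each $n$ let $P_0=P_0^{(n)}$ be a discrete probability distribution on $\mathbb{R}^n$, and let $X,X'$ be independent draws from $P_0$, with overlap $\langle X,X'\rangle$. - *Quantile.* For $D>0$, $q(D)=\inf\{y\in\mathbb{R}: \mathbb{P}(|\langle X,X'\rangle|\le y)\ge 1-e^{-D}\}$. - *Overlap PMF.* $f_{\mathrm{ov}}(t)=\mathbb{P}(\langle X,X'\rangle=t)$ and $\mathcal{S}_{\mathrm{ov}}=\{t\in\mathbb{R}: f_{\mathrm{ov}}(t)>0\}$. - *Annealed Franz–Parisi potential.* $\mathcal{F}_{\mathrm{ann},\lambda}(q)=-\log\mathbb{E}\big[\mathbf 1_{\langle X,X'\rangle=q}\,e^{\lambda\langle X,X'\rangle}\big]$. - *Difference operator.* $\mathbf{\Delta}_{a}f(q)=\dfrac{f(q+a(q))-f(q)}{a(q)}$, for a step $a(q)>0$ and $q,\ q+a(q)\in\mathcal{S}_{\mathrm{ov}}$. - *Degree-$D$ correlation.* For the Gaussian additive model $Y=\sqrt{\lambda}X+Z$ with $Z\sim N(0,I_n)$ independent of $X\sim P_0$, $$\mathrm{Corr}^{\le D}_{P_0}(\lambda)=\sqrt{\sum_{i=1}^n\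 \sup\big\{\mathbb{E}[g(Y)X_i]^2:\ g\in\mathbb{R}[Y]_{\le D},\ \mathbb{E}[g(Y)^2]=1\big\}} .$$ - *Cumulants.* For a multi-index $\alpha\in\mathbb{N}^n$, $\kappa_\alpha(X_1,\dots,X_n)$ is the joint cumulant of the family containing $\alpha_i$ copies of $X_i$ for each $i$; the joint cumulant of $W_1,\dots,W_m$ is $\sum_{\pi}(-1)^{|\pi|-1}(|\pi|-1)!\prod_{B\in\pi}\mathbb{E}\prod_{j\in B}W_j$ over set partitions $\pi$ of $\{1,\dots,m\}$ (and it is $0$ for the empty family). **Assumptions.** Let $C>0$, let $D_n$ be positive integers with $D_n\le n^C$, let $A_n>0$, and let $a_n$ be step functions. Assume that for all sufficiently large $n$: 0. $q(D_n)\in\mathcal{S}_{\mathrm{ov}}$, $a_n(q(D_n))>0$ and $q(D_n)+a_n(q(D_n))\in\mathcal{S}_{\mathrm{ov}}$; 1. $\kappa_\alpha(X_1,\dots,X_n)\ge 0$ for every $\alpha\in\mathbb{N}^n$ with $|\alpha|\le D_n$; 2. $(\mathbb{E}|X_i|^p)^{1/p}\le K p^{1/\phi}$ for all real $p\ge1$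 and all $i\in[n]$, where $\phi,K>0$ do not depend on $i$ or $n$; 3. $q(D_n(\log n)^2)\ge\max\{(\log n)^{-D_n/2},\,n^{-C_1}\}$, where $C_1>0$ does not depend on $n$; 4. $\displaystyle \mathbf{\Delta}_{a_n}\log f_{\mathrm{ov}}\big|_{q(D_n)}\ \ge\ -\frac{A_n}{q(D_n(\log n)^2)\,\log n}$. Let $D_n'$ be positive integers with $D_n'=(1+o(1))D_n(\log n)^2$, and assume that $q(D_n')\ge n^{-C_2}$ for some constant $C_2>0$ and all sufficiently large $n$ (by 3, this is automatic if $D_n'\ge D_n(\log n)^2$). **Conclusion.** For all sufficiently large $n$, the following hold. - For every $u>0$ with $u+\mathbf{\Delta}_{a_n}\mathcal{F}_{\mathrm{ann},u}\big|_{q(D_n)}>0$, $$\mathrm{Corr}^{\le D_n}_{P_0}\Big(\tfrac1{A_n}\big(u+\mathbf{\Delta}_{a_n}\mathcal{F}_{\mathrm{ann},u}\big|_{q(D_n)}\big)\Big)^2\le 2\,q(D_n').$$ - For every $\lambda>0$, if $\mathbf{\Delta}_{a_n}\mathcal{F}_{\mathrm{ann},\lambda}\big|_{q(D_n)}\ge0$,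 then $\mathrm{Corr}^{\le D_n}_{P_0}(\lambda/A_n)^2\le 2\,q(D_n')$. -/

import Mathlib

open MeasureTheory ProbabilityTheory Filter Topology Asymptotics
open scoped ENNReal

namespace GAM

noncomputable section

/-- Joint cumulant of a finite family `Y` of real random variables on `(Ω, μ)`:
`κ(Y) = ∑_π (-1)^(|π|-1) (|π|-1)! ∏_{B ∈ π} E[∏_{j ∈ B} Y j]`, the sum running over the set
partitions `π` of the index set. This makes sense as soon as all moments are finite, and equals the
mixed derivative of the cumulant generating function at `0` when the latter is finite near `0`.
For an empty family the only partition has no block; it is left out, so the value is `log 1 = 0`. -/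
def jointCumulant {Ω ι : Type*} [MeasurableSpace Ω] [Fintype ι] [DecidableEq ι]
    (μ : Measure Ω) (Y : ι → Ω → ℝ) : ℝ :=
  ∑ π : Finpartition (Finset.univ : Finset ι),
    if π.parts.card = 0 then 0
    else (-1 : ℝ) ^ (π.parts.card - 1) * ((π.parts.card - 1).factorial : ℝ) *
      ∏ B ∈ π.parts, ∫ ω, ∏ j ∈ B, Y j ω ∂μ

/-- `κ_α(X₁, …, X_n)` for `X ∼ μ` and a multi-index `α`: the joint cumulant of the family that
contains `α i` copies of the coordinate `X i`. -/
def cumulant {n : ℕ} (μ : Measure (Fin n → ℝ)) (α : Fin n → ℕ) : ℝ :=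
  jointCumulant μ (fun (j : (i : Fin n) × Fin (α i)) (x : Fin n → ℝ) => x j.1)

/-- `Y` is sub-Weibull of order `φ` with constant `K`: `(E|Y|^p)^(1/p) ≤ K p^(1/φ)` for all
real `p ≥ 1` (in particular these moments are finite). -/
def IsSubWeibull {Ω : Type*} [MeasurableSpace Ω] (φ K : ℝ) (Y : Ω → ℝ) (μ : Measure Ω) : Prop :=
  ∀ p : ℝ, 1 ≤ p → eLpNorm Y (ENNReal.ofReal p) μ ≤ ENNReal.ofReal (K * p ^ (1 / φ))

/-- The law of two independent draws `(X, X')` from `μ`. -/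
def replicas {n : ℕ} (μ : Measure (Fin n → ℝ)) : Measure ((Fin n → ℝ) × (Fin n → ℝ)) :=
  μ.prod μ

/-- The overlap `⟨X, X'⟩ = ∑ i, X i * X' i`. -/
def overlap {n : ℕ} (z : (Fin n → ℝ) × (Fin n → ℝ)) : ℝ :=
  ∑ i, z.1 i * z.2 i

/-- The quantile `q(D) = inf {y | P(|⟨X, X'⟩| ≤ y) ≥ 1 - e^(-D)}`, for `D > 0`. -/
def quantile {n : ℕ} (μ : Measure (Fin n → ℝ)) (D : ℝ) : ℝ :=
  sInf {y : ℝ | 1 - Real.exp (-D) ≤ (replicas μ).real {z | |overlap z| ≤ y}}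

/-- The probability mass function `f_ov(t) = P(⟨X, X'⟩ = t)` of the overlap. -/
def overlapPMF {n : ℕ} (μ : Measure (Fin n → ℝ)) (t : ℝ) : ℝ :=
  (replicas μ).real {z | overlap z = t}

/-- `S_ov = {t | f_ov(t) > 0}`. -/
def overlapSupport {n : ℕ} (μ : Measure (Fin n → ℝ)) : Set ℝ :=
  {t | 0 < overlapPMF μ t}

/-- The annealed Franz-Parisi potential
`F_ann,lam(q) = - log E[1{⟨X, X'⟩ = q} exp(lam ⟨X, X'⟩)]`. -/
def annealedFP {n : ℕ} (μ : Measure (Fin n → ℝ)) (lam q : ℝ) : ℝ :=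
  - Real.log (∫ z, Set.indicator {z | overlap z = q} (fun z => Real.exp (lam * overlap z)) z
      ∂(replicas μ))

/-- The discrete difference operator `Δ_a f (q) = (f(q + a(q)) - f(q)) / a(q)`. It is only used at
points with `a(q) > 0` and with `q`, `q + a(q)` in the support of the overlap. -/
def discreteDeriv (a : ℝ → ℝ) (f : ℝ → ℝ) (q : ℝ) : ℝ :=
  (f (q + a q) - f q) / a q

/-- The law of `(X, Z)` with `X ∼ μ` and `Z ∼ N(0, I_n)` independent. -/
def signalNoise {n : ℕ} (μ : Measure (Fin n → ℝ)) : Measure ((Fin n → ℝ) × (Fin n → ℝ)) :=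
  μ.prod (Measure.pi fun _ => gaussianReal 0 1)

/-- The observation `Y = √lam X + Z` of the Gaussian additive model with signal-to-noise
ratio `lam`. -/
def observation {n : ℕ} (lam : ℝ) (w : (Fin n → ℝ) × (Fin n → ℝ)) : Fin n → ℝ :=
  fun i => Real.sqrt lam * w.1 i + w.2 i

/-- The degree-`D` correlation
`Corr^{≤D}(lam) = √(∑ i, sup {E[g(Y) X_i]² : g polynomial, deg g ≤ D, E[g(Y)²] = 1})`. -/
def corr {n : ℕ} (μ : Measure (Fin n → ℝ)) (D : ℕ) (lam : ℝ) : ℝ :=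
  Real.sqrt (∑ i : Fin n, sSup {r : ℝ | ∃ g : MvPolynomial (Fin n) ℝ, g.totalDegree ≤ D ∧
    ∫ w, (MvPolynomial.eval (observation lam w) g) ^ 2 ∂(signalNoise μ) = 1 ∧
    r = (∫ w, MvPolynomial.eval (observation lam w) g * w.1 i ∂(signalNoise μ)) ^ 2})

/-- A sequence of discrete priors `P n` on `ℝ^n` is low-order cumulant-nonnegative with parameters
`D`, `A`, `a`, `C`. -/
structure CumulantNonneg (P : (n : ℕ) → PMF (Fin n → ℝ)) (D : ℕ → ℕ) (A : ℕ → ℝ)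
    (a : ℕ → ℝ → ℝ) (C : ℝ) : Prop where
  C_pos : 0 < C
  D_pos : ∀ n, 0 < D n
  D_le : ∀ᶠ n : ℕ in atTop, (D n : ℝ) ≤ (n : ℝ) ^ C
  A_pos : ∀ n, 0 < A n
  /-- The operator `Δ_{a n}` can be evaluated at `q(D n)`. -/
  step : ∀ᶠ n : ℕ in atTop,
    quantile (P n).toMeasure (D n) ∈ overlapSupport (P n).toMeasure ∧
    0 < a n (quantile (P n).toMeasure (D n)) ∧
    quantile (P n).toMeasure (D n) + a n (quantile (P n).toMeasure (D n)) ∈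
      overlapSupport (P n).toMeasure
  /-- Cumulants of order at most `D n` are nonnegative. -/
  cumulant_nonneg : ∀ᶠ n : ℕ in atTop, ∀ α : Fin n → ℕ, ∑ i, α i ≤ D n →
    0 ≤ cumulant (P n).toMeasure α
  /-- Polynomial growth of the marginal moments, uniformly in the coordinate and in `n`. -/
  subWeibull : ∃ φ > 0, ∃ K > 0, ∀ᶠ n : ℕ in atTop, ∀ i : Fin n,
    IsSubWeibull φ K (fun x : Fin n → ℝ => x i) (P n).toMeasure
  /-- Controlled decay of the overlap quantiles. -/
  quantile_decay : ∃ C₁ : ℝ, 0 < C₁ ∧ ∀ᶠ n : ℕ in atTop,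
    max (Real.log n ^ (-(D n : ℝ) / 2)) ((n : ℝ) ^ (-C₁)) ≤
      quantile (P n).toMeasure (D n * Real.log n ^ 2)
  /-- Quantile stability. -/
  quantile_stability : ∀ᶠ n : ℕ in atTop,
    - (A n / (quantile (P n).toMeasure (D n * Real.log n ^ 2) * Real.log n)) ≤
      discreteDeriv (a n) (fun t => Real.log (overlapPMF (P n).toMeasure t))
        (quantile (P n).toMeasure (D n))

end

end GAM

/-! The proof is by duality. Write `m_α`, `κ_α` for the moments and cumulants of `X`. The noise
polynomial `W_i(Z) = ∑_{|β| ≤ D} κ_{β+e_i} λ^{|β|/2} H_β(Z) / β!` satisfies `E[W_i(Z) g(Y)] = E[X_i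
g(Y)]` for every `g` of degree at most `D`: tested on Hermite polynomials, this is the
moment-cumulant recursion (`integral_dualCertificate_mul_eval`). Cauchy-Schwarz and Hermite
orthogonality then give `Corr² ≤ ∑_i ∑_β κ_{β+e_i}² λ^{|β|} / β!` (`corr_sq_le`).

Nonnegative cumulants make the low-order moments nonnegative and dominate the cumulants, so solving
the recursion for `κ_{α+e_i}` bounds it by a binomial convolution of moments (`abs_cumulant_le`).
Squared moments weighted by `1/α!` assemble into overlap moments, because `E⟨X,X'⟩^k = k! ∑_{|α|=k}
m_α² / α!`. If these are at most `b q^k` for `k ≤ D + 1`, the series sums to `b² q exp(4λq)`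
(`corr_sq_le_of_overlap_moments`).

Take `q = q(T)` with `T` at least `D (log n)² / 2`. The overlap exceeds `q` in absolute value with
probability at most `e^{-T}`, while the sub-Weibull bound limits its moments of order `O(D)` to
`e^{O(D log n)}`; the tail contribution is therefore negligible against `q^k`, which is only
polynomially small per power. With `λq ≤ 1/log n` the bound becomes `2q`
(`corr_sq_le_two_mul_quantile`). Finally, `u + Δ F_{ann,u} = -Δ log f_ov` does not depend on `u`,
and quantile stability says that this quantity divided by `A_n` is an admissible `λ`. -/

namespace GAM

noncomputable section

/-! ### Set-partition cumulants and their recursion. -/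

section Cumulants

variable {ι : Type*} [DecidableEq ι]

/-- The combinatorial cumulant of a set function `M`: the alternating sum over set partitions. -/
def setCumulant (M : Finset ι → ℝ) (S : Finset ι) : ℝ :=
  ∑ π : Finpartition S,
    if π.parts.card = 0 then 0
    else (-1 : ℝ) ^ (π.parts.card - 1) * ((π.parts.card - 1).factorial : ℝ) * ∏ B ∈ π.parts, M B

/-- Removing a block `C` that avoids `j` from a partition of `S`, or adding it back. -/
theorem sum_extend_finpartition (S : Finset ι) (j : ι)
    (F : Finset (Finset ι) → Finset ι → ℝ) :
    ∑ C ∈ (S.erase j).powerset.filter (· ≠ ∅), ∑ π : Finpartition (S \ C), F (insert C π.parts) C =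
      ∑ σ : Finpartition S, ∑ C ∈ σ.parts.filter (j ∉ ·), F σ.parts C := by
  rw [Finset.sum_sigma', Finset.sum_sigma']
  have sub : ∀ {C}, C ∈ (S.erase j).powerset.filter (· ≠ ∅) → C ⊆ S ∧ j ∉ C ∧ C ≠ ∅ := by
    intro C hC
    simp only [Finset.mem_filter, Finset.mem_powerset] at hC
    exact ⟨hC.1.trans (Finset.erase_subset _ _), fun h => by simpa using hC.1 h, hC.2⟩
  have notMem : ∀ {C} (π : Finpartition (S \ C)), C ≠ ∅ → C ∉ π.parts := by
    intro C π hC h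
    obtain ⟨x, hx⟩ := Finset.nonempty_iff_ne_empty.2 hC
    have := π.subset h hx
    simp [hx] at this
  refine Finset.sum_bij
    (fun x hx => ⟨x.2.extend (b := x.1) (c := S) (sub (Finset.mem_sigma.1 hx).1).2.2
      Finset.sdiff_disjoint (Finset.sdiff_union_of_subset (sub (Finset.mem_sigma.1 hx).1).1), x.1⟩)
    ?_ ?_ ?_ ?_
  · rintro ⟨C, π⟩ hx
    have h := sub (Finset.mem_sigma.1 hx).1
    simp [h.2.1]
  · rintro ⟨C, π⟩ hx ⟨C', π'⟩ hx' h
    have hC : C = C' := by simpa using congrArg Sigma.snd h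
    subst hC
    have h1 : (insert C π.parts) = insert C π'.parts := by
      have := congrArg (fun z => z.1.parts) h
      simpa using this
    have hne := (sub (Finset.mem_sigma.1 hx).1).2.2
    congr 1
    apply Finpartition.ext
    rw [← Finset.erase_insert (notMem π hne), h1, Finset.erase_insert (notMem π' hne)]
  · rintro ⟨σ, C⟩ hx
    simp only [Finset.mem_sigma, Finset.mem_univ, Finset.mem_filter, true_and] at hx
    -- The other blocks are disjoint from `C`, so `avoid` only deletes `C`; this makes it inverse to
    -- `extend`.
    have hav : (σ.avoid C).parts = σ.parts.erase C := by
      ext B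
      rw [Finpartition.mem_avoid, Finset.mem_erase]
      constructor
      · rintro ⟨d, hd, hdC, rfl⟩
        have hne : d ≠ C := fun h => hdC h.le
        have : Disjoint d C := σ.disjoint hd hx.1 hne
        rw [Finset.sdiff_eq_self_of_disjoint this]
        exact ⟨hne, hd⟩
      · rintro ⟨hne, hB⟩
        have : Disjoint B C := σ.disjoint hB hx.1 hne
        refine ⟨B, hB, fun hle => ?_, Finset.sdiff_eq_self_of_disjoint this⟩
        exact σ.ne_empty hB (Finset.disjoint_self_iff_empty _ |>.1
          (this.mono_right hle))
    refine ⟨⟨C, σ.avoid C⟩, ?_, ?_⟩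
    · simp only [Finset.mem_sigma, Finset.mem_univ, Finset.mem_filter, Finset.mem_powerset, and_true]
      exact ⟨fun x hxC => Finset.mem_erase.2 ⟨fun h => hx.2 (h ▸ hxC), σ.subset hx.1 hxC⟩,
        σ.ne_empty hx.1⟩
    · have : (σ.avoid C).extend (b := C) (c := S) (σ.ne_empty hx.1) Finset.sdiff_disjoint
        (Finset.sdiff_union_of_subset (σ.subset hx.1)) = σ := by
        apply Finpartition.ext
        simp [hav, Finset.insert_erase hx.1]
      simp only [this]
  · rintro ⟨C, π⟩ hx
    simp

/-- Only the block containing `j` is discarded. This count turns `(|σ|-2)!` into `(|σ|-1)!` in the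
recursion below. -/
theorem card_parts_filter_notMem {S : Finset ι} (σ : Finpartition S) {j : ι} (hj : j ∈ S) :
    (σ.parts.filter (j ∉ ·)).card = σ.parts.card - 1 := by
  have : σ.parts.filter (j ∉ ·) = σ.parts.erase (σ.part j) := by
    ext B
    simp only [Finset.mem_filter, Finset.mem_erase]
    constructor
    · rintro ⟨hB, hjB⟩
      exact ⟨fun h => hjB (h ▸ σ.mem_part_self.2 hj), hB⟩
    · rintro ⟨hne, hB⟩
      exact ⟨hB, fun h => hne (σ.part_eq_of_mem hB h).symm⟩
  rw [this, Finset.card_erase_of_mem (σ.part_mem.2 hj)]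

/-- The recursion between set functions and their cumulants. -/
theorem eq_sum_setCumulant_mul (M : Finset ι → ℝ) (hM : M ∅ = 1) {S : Finset ι} {j : ι}
    (hj : j ∈ S) :
    M S = ∑ C ∈ (S.erase j).powerset, setCumulant M (S \ C) * M C := by
  have hsplit : (S.erase j).powerset = insert ∅ ((S.erase j).powerset.filter (· ≠ ∅)) := by
    ext C; by_cases h : C = ∅ <;> simp [h]
  rw [hsplit, Finset.sum_insert (by simp), hM, mul_one, Finset.sdiff_empty]
  have hcard : ∀ C ∈ (S.erase j).powerset.filter (· ≠ ∅), ∀ π : Finpartition (S \ C),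
      C ∉ π.parts ∧ π.parts.card ≠ 0 := by
    intro C hC π
    simp only [Finset.mem_filter, Finset.mem_powerset] at hC
    constructor
    · intro h
      obtain ⟨x, hx⟩ := Finset.nonempty_iff_ne_empty.2 hC.2
      have := π.subset h hx
      simp [hx] at this
    · have : j ∈ S \ C := Finset.mem_sdiff.2 ⟨hj, fun h => by simpa using hC.1 h⟩
      exact (Finset.card_pos.2 (π.parts_nonempty (Finset.ne_empty_of_mem this))).ne'
  -- Adding the block `C` raises the number of blocks by one, so the cumulant weight is rewritten
  -- with `card - 2`, as a function of the enlarged partition.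
  have h2 : ∑ C ∈ (S.erase j).powerset.filter (· ≠ ∅), setCumulant M (S \ C) * M C =
      ∑ C ∈ (S.erase j).powerset.filter (· ≠ ∅), ∑ π : Finpartition (S \ C),
        (fun (p : Finset (Finset ι)) (_ : Finset ι) =>
          (-1 : ℝ) ^ (p.card - 2) * ((p.card - 2).factorial : ℝ) * ∏ B ∈ p, M B)
          (insert C π.parts) C := by
    refine Finset.sum_congr rfl fun C hC => ?_
    rw [setCumulant, Finset.sum_mul]
    refine Finset.sum_congr rfl fun π _ => ?_
    obtain ⟨h1, h0⟩ := hcard C hC π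
    rw [if_neg h0]
    simp only [Finset.card_insert_of_notMem h1, Finset.prod_insert h1]
    rw [show π.parts.card + 1 - 2 = π.parts.card - 1 by omega]
    ring
  rw [h2, sum_extend_finpartition S j (fun (p : Finset (Finset ι)) (_ : Finset ι) =>
    (-1 : ℝ) ^ (p.card - 2) * ((p.card - 2).factorial : ℝ) * ∏ B ∈ p, M B), setCumulant,
    ← Finset.sum_add_distrib]
  have hSne : S ≠ ∅ := Finset.ne_empty_of_mem hj
  -- The one-block partition yields `M S`. For `m + 2` blocks, the `m + 1` choices of `C`, each of
  -- weight `(-1)^m m!`, cancel the weight `(-1)^(m+1) (m+1)!` in the cumulant of `S`.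
  rw [Finset.sum_eq_single (Finpartition.indiscrete (a := S) hSne)]
  · have hf : ({S} : Finset (Finset ι)).filter (j ∉ ·) = ∅ := by simp [hj]
    simp [hf]
  · intro σ _ hσ
    have h0 : σ.parts.card ≠ 0 := (Finset.card_pos.2 (σ.parts_nonempty hSne)).ne'
    have h1 : σ.parts.card ≠ 1 := by
      intro h
      apply hσ
      obtain ⟨B, hB⟩ := Finset.card_eq_one.1 h
      apply Finpartition.ext
      have := σ.sup_parts
      rw [hB] at this
      simp only [Finset.sup_singleton, id] at this
      simp [hB, this]
    rw [if_neg h0, Finset.sum_const, card_parts_filter_notMem σ hj]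
    obtain ⟨m, hm⟩ : ∃ m, σ.parts.card = m + 2 := ⟨σ.parts.card - 2, by omega⟩
    rw [hm, show m + 2 - 1 = m + 1 by omega, show m + 2 - 2 = m by omega, Nat.factorial_succ,
      pow_succ, nsmul_eq_mul]
    push_cast
    ring
  · simp

/-- Cumulants are natural with respect to relabelling of the index set. -/
theorem setCumulant_map {κ : Type*} [DecidableEq κ] (M : Finset ι → ℝ) (N : Finset κ → ℝ)
    (hM : M ∅ = 1) (f : κ ↪ ι) (h : ∀ T, N T = M (T.map f)) (T : Finset κ) (hT : T.Nonempty) :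
    setCumulant N T = setCumulant M (T.map f) := by
  -- The recursion determines the cumulant of `T` from the set function and the cumulants of proper
  -- subsets, so partitions need not be transported.
  induction T using Finset.strongInduction with
  | H T ih =>
    obtain ⟨j, hj⟩ := hT
    have hN : N ∅ = 1 := by rw [h]; simpa using hM
    have e1 := eq_sum_setCumulant_mul N hN hj
    have e2 := eq_sum_setCumulant_mul M hM (Finset.mem_map_of_mem f hj)
    have hp : ((T.map f).erase (f j)).powerset =
        (T.erase j).powerset.map ⟨fun C => C.map f, Finset.map_injective f⟩ := by
      rw [← Finset.map_erase]
      ext C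
      simp only [Finset.mem_powerset, Finset.mem_map, Function.Embedding.coeFn_mk]
      rw [Finset.subset_map_iff]
      constructor
      · rintro ⟨u, hu, rfl⟩; exact ⟨u, hu, rfl⟩
      · rintro ⟨u, hu, rfl⟩; exact ⟨u, hu, rfl⟩
    rw [hp, Finset.sum_map] at e2
    simp only [Function.Embedding.coeFn_mk] at e2
    have hmem : ∅ ∈ (T.erase j).powerset := by simp
    rw [← Finset.add_sum_erase _ _ hmem] at e1 e2
    have hs : ∑ C ∈ (T.erase j).powerset.erase ∅, setCumulant N (T \ C) * N C =
        ∑ C ∈ (T.erase j).powerset.erase ∅,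
          setCumulant M (T.map f \ C.map f) * M (C.map f) := by
      refine Finset.sum_congr rfl fun C hC => ?_
      simp only [Finset.mem_erase, Finset.mem_powerset] at hC
      have hjC : j ∉ C := fun hh => by simpa using hC.2 hh
      rw [ih (T \ C) ?_ ⟨j, by simp [hj, hjC]⟩, h C]
      · congr 2
        ext x; simp only [Finset.mem_map, Finset.mem_sdiff]
        constructor
        · rintro ⟨y, ⟨h1, h2⟩, rfl⟩
          exact ⟨⟨y, h1, rfl⟩, fun ⟨z, hz, e⟩ => h2 (f.injective e ▸ hz)⟩
        · rintro ⟨⟨y, h1, rfl⟩, h2⟩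
          exact ⟨y, ⟨h1, fun hy => h2 ⟨y, hy, rfl⟩⟩, rfl⟩
      · refine Finset.sdiff_ssubset (hC.2.trans (Finset.erase_subset _ _))
          (Finset.nonempty_iff_ne_empty.2 hC.1)
    rw [hs, h T] at e1
    simp only [Finset.map_empty, Finset.sdiff_empty, hM, hN, mul_one] at e1 e2
    linarith

theorem jointCumulant_eq_setCumulant {Ω : Type*} [MeasurableSpace Ω] [Fintype ι] (μ : Measure Ω)
    (Y : ι → Ω → ℝ) :
    jointCumulant μ Y = setCumulant (fun B => ∫ ω, ∏ j ∈ B, Y j ω ∂μ) Finset.univ := rfl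

end Cumulants

/-! ### Moments and cumulants indexed by multi-indices. -/

/-- The moment `E[X^α]` of a multi-index `α`. -/
def moment {n : ℕ} (μ : Measure (Fin n → ℝ)) (α : Fin n → ℕ) : ℝ :=
  ∫ x, ∏ i, x i ^ α i ∂μ

section

variable {n : ℕ} {ι : Type*}

/-- The number of elements of `B` of each colour. -/
def colourCount (c : ι → Fin n) (B : Finset ι) (k : Fin n) : ℕ :=
  (B.filter (c · = k)).card

theorem prod_eq_prod_pow_colourCount (c : ι → Fin n) (B : Finset ι) (x : Fin n → ℝ) :
    ∏ t ∈ B, x (c t) = ∏ k, x k ^ colourCount c B k := by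
  rw [← Finset.prod_fiberwise_of_maps_to (g := c) (t := Finset.univ) (by simp)]
  refine Finset.prod_congr rfl fun k _ => ?_
  rw [colourCount, Finset.prod_congr rfl (g := fun _ => x k), Finset.prod_const]
  intro t ht
  rw [(Finset.mem_filter.1 ht).2]

theorem integral_prod_eq_moment (μ : Measure (Fin n → ℝ)) (c : ι → Fin n) (B : Finset ι) :
    ∫ x : Fin n → ℝ, ∏ t ∈ B, x (c t) ∂μ = moment μ (colourCount c B) := by
  simp only [prod_eq_prod_pow_colourCount, moment]

/-- Enumerating the elements of `B` of each colour identifies `B` with the index family used in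
`cumulant`; naturality under relabelling does the rest. -/
theorem setCumulant_eq_cumulant (μ : Measure (Fin n → ℝ)) [IsProbabilityMeasure μ]
    [DecidableEq ι] (c : ι → Fin n) (B : Finset ι) (hB : B.Nonempty) :
    setCumulant (fun T => ∫ x : Fin n → ℝ, ∏ t ∈ T, x (c t) ∂μ) B =
      cumulant μ (colourCount c B) := by
  let f : ((k : Fin n) × Fin (colourCount c B k)) → ι :=
    fun t => ((B.filter (c · = t.1)).equivFin.symm t.2 : ι)
  have hfm : ∀ t, f t ∈ B ∧ c (f t) = t.1 := fun t =>
    Finset.mem_filter.1 ((B.filter (c · = t.1)).equivFin.symm t.2).2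
  have hf : Function.Injective f := by
    rintro ⟨k, l⟩ ⟨k', l'⟩ h
    have hk : k = k' := (hfm ⟨k, l⟩).2.symm.trans ((congrArg c h).trans (hfm ⟨k', l'⟩).2)
    subst hk
    have : l = l' := (B.filter (c · = k)).equivFin.symm.injective (Subtype.ext h)
    rw [this]
  have hu : Finset.univ.map ⟨f, hf⟩ = B := by
    ext t
    simp only [Finset.mem_map, Finset.mem_univ, true_and, Function.Embedding.coeFn_mk]
    constructor
    · rintro ⟨s, rfl⟩; exact (hfm s).1
    · intro ht
      refine ⟨⟨c t, (B.filter (c · = c t)).equivFin ⟨t, by simp [ht]⟩⟩, ?_⟩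
      simp [f]
  rw [cumulant, jointCumulant_eq_setCumulant]
  conv_lhs => rw [← hu]
  symm
  refine setCumulant_map _ _ (by simp) ⟨f, hf⟩ ?_ _ ?_
  · intro T
    simp only [Finset.prod_map, Function.Embedding.coeFn_mk, (hfm _).2]
  · rw [← Finset.card_pos, ← Finset.card_map ⟨f, hf⟩, hu]
    exact hB.card_pos

/-- A subset of the disjoint union is a tuple of subsets, and `∏ choose (α k) (γ k)` of these tuples
have sizes `γ`. -/
theorem sum_finset_sigma_eq (α : Fin n → ℕ) (F : (Fin n → ℕ) → ℝ) :
    ∑ T : Finset ((k : Fin n) × Fin (α k)), F (colourCount Sigma.fst T) =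
      ∑ γ ∈ Finset.Iic α, ((∏ k, (α k).choose (γ k) : ℕ) : ℝ) * F γ := by
  let e : (∀ k, Finset (Fin (α k))) ≃ Finset ((k : Fin n) × Fin (α k)) :=
    { toFun := fun t => Finset.univ.sigma t
      invFun := fun T k => Finset.univ.filter fun l => (⟨k, l⟩ : (k : Fin n) × Fin (α k)) ∈ T
      left_inv := fun t => by ext; simp
      right_inv := fun T => by ext; simp }
  have he : ∀ t, colourCount Sigma.fst (e t) = fun k => (t k).card := by
    intro t
    funext k
    rw [colourCount, ← Finset.card_map (Function.Embedding.sigmaMk (β := fun k => Fin (α k)) k) (s := t k)]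
    congr 1
    ext ⟨k', l⟩
    simp only [e, Equiv.coe_fn_mk, Finset.mem_filter, Finset.mem_sigma, Finset.mem_univ, true_and,
      Finset.mem_map, Function.Embedding.sigmaMk_apply]
    constructor
    · rintro ⟨h, rfl⟩; exact ⟨l, h, rfl⟩
    · rintro ⟨l', h, h'⟩
      cases h'
      exact ⟨h, rfl⟩
  rw [← e.sum_comp]
  simp only [he]
  rw [← Finset.sum_fiberwise_of_maps_to (g := fun t : (∀ k, Finset (Fin (α k))) =>
    fun k => (t k).card) (t := Finset.Iic α)]
  · refine Finset.sum_congr rfl fun γ _ => ?_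
    rw [Finset.sum_congr rfl (g := fun _ => F γ), Finset.sum_const, nsmul_eq_mul]
    · congr 2
      have : (Finset.univ.filter fun t : (∀ k, Finset (Fin (α k))) => (fun k => (t k).card) = γ) =
          Fintype.piFinset fun k => Finset.powersetCard (γ k) (Finset.univ : Finset (Fin (α k))) := by
        ext t
        simp [Finset.mem_powersetCard, funext_iff]
      rw [this, Fintype.card_piFinset]
      simp
    · intro t ht
      rw [(Finset.mem_filter.1 ht).2]
  · intro t _
    rw [Finset.mem_Iic]
    intro k
    simpa using Finset.card_le_univ (t k)

/-- The moment-cumulant recursion for multi-indices. -/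
theorem moment_add_single (μ : Measure (Fin n → ℝ)) [IsProbabilityMeasure μ] (α : Fin n → ℕ)
    (i : Fin n) :
    moment μ (α + Pi.single i 1) = ∑ γ ∈ Finset.Iic α, ((∏ k, (α k).choose (γ k) : ℕ) : ℝ) *
      (cumulant μ (α - γ + Pi.single i 1) * moment μ γ) := by
  -- The additional copy of `X i` is `none`, which serves as the distinguished element of the set
  -- recursion.
  let c : Option ((k : Fin n) × Fin (α k)) → Fin n := fun t => t.elim i Sigma.fst
  have hsome : ∀ T : Finset ((k : Fin n) × Fin (α k)),
      colourCount c (T.map Function.Embedding.some) = colourCount Sigma.fst T := by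
    intro T
    funext k
    rw [colourCount, colourCount, Finset.filter_map, Finset.card_map]
    rfl
  have hfull : colourCount (Sigma.fst (β := fun k => Fin (α k))) Finset.univ = α := by
    funext k
    have hk := (Finset.card_map (Function.Embedding.sigmaMk (β := fun k => Fin (α k)) k)
      (s := Finset.univ)).trans (Finset.card_fin (α k))
    rw [colourCount]
    refine Eq.trans ?_ hk
    congr 1
    ext ⟨k', l⟩
    simp only [Finset.mem_filter, Finset.mem_univ, true_and,
      Finset.mem_map, Function.Embedding.sigmaMk_apply]
    constructor
    · rintro rfl; exact ⟨l, rfl⟩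
    · rintro ⟨l', h'⟩
      cases h'
      rfl
  have hcompl : ∀ T : Finset ((k : Fin n) × Fin (α k)),
      colourCount c (Finset.univ \ T.map Function.Embedding.some) =
        α - colourCount Sigma.fst T + Pi.single i 1 := by
    intro T
    have h1 : Finset.univ \ T.map Function.Embedding.some =
        Finset.insertNone (Finset.univ \ T) := by
      ext (_ | t) <;> simp
    funext k
    rw [h1, colourCount]
    have h2 : (Finset.insertNone (Finset.univ \ T)).filter (c · = k) =
        (if i = k then {none} else ∅) ∪
          ((Finset.univ \ T).filter (Sigma.fst · = k)).map Function.Embedding.some := by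
      ext (_ | t)
      · by_cases h : i = k <;> simp [c, h]
      · by_cases h : i = k <;> simp [c, h]
    rw [h2, Finset.card_union_of_disjoint, Finset.card_map]
    · have h3 : ((Finset.univ \ T).filter (Sigma.fst · = k)).card =
          α k - colourCount Sigma.fst T k := by
        rw [← (congrFun hfull k : _ = α k), colourCount, colourCount, ← Finset.card_sdiff_of_subset
          (Finset.filter_subset_filter _ (Finset.subset_univ T))]
        congr 1
        ext t
        simp only [Finset.mem_filter, Finset.mem_sdiff, Finset.mem_univ, true_and]
        tauto
      rw [h3]
      by_cases h : i = k
      · subst h; simp [add_comm]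
      · simp [h, Ne.symm h]
    · by_cases h : i = k <;> simp [h]
  have key := eq_sum_setCumulant_mul
    (fun T => ∫ x : Fin n → ℝ, ∏ t ∈ T, x (c t) ∂μ) (by simp) (Finset.mem_univ none)
  have hp : ((Finset.univ : Finset (Option ((k : Fin n) × Fin (α k)))).erase none).powerset =
      Finset.univ.map ⟨fun T : Finset ((k : Fin n) × Fin (α k)) => T.map Function.Embedding.some,
        Finset.map_injective Function.Embedding.some⟩ := by
    ext C
    simp only [Finset.mem_powerset, Finset.mem_map, Finset.mem_univ, true_and,
      Function.Embedding.coeFn_mk]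
    constructor
    · intro h
      refine ⟨C.eraseNone, ?_⟩
      rw [Finset.map_some_eraseNone, Finset.erase_eq_of_notMem]
      intro hn
      simpa using h hn
    · rintro ⟨T, rfl⟩ t ht
      simp only [Finset.mem_map] at ht
      obtain ⟨s, _, rfl⟩ := ht
      simp
  rw [hp, Finset.sum_map] at key
  simp only [Function.Embedding.coeFn_mk] at key
  rw [integral_prod_eq_moment] at key
  have h0 := hcompl ∅
  simp only [Finset.map_empty, Finset.sdiff_empty] at h0
  have h00 : colourCount (Sigma.fst (β := fun k => Fin (α k))) ∅ = 0 := by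
    funext k; simp [colourCount]
  rw [h0, h00, tsub_zero] at key
  rw [key]
  refine Eq.trans ?_ (sum_finset_sigma_eq α
    (fun γ => cumulant μ (α - γ + Pi.single i 1) * moment μ γ))
  refine Finset.sum_congr rfl fun T _ => ?_
  rw [setCumulant_eq_cumulant, integral_prod_eq_moment, hsome, hcompl]
  exact ⟨none, by simp⟩

end

/-! ### A class of functions stable under polynomial operations, for integrability. -/

section AllMoments

variable {Ω : Type*} [MeasurableSpace Ω] {μ : Measure Ω} {f g : Ω → ℝ}

/-- `f` has finite absolute moments of all orders. -/
def AllMoments (f : Ω → ℝ) (μ : Measure Ω) : Prop :=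
  ∀ p : ℝ≥0∞, p ≠ ∞ → MemLp f p μ

theorem AllMoments.integrable (hf : AllMoments f μ) : Integrable f μ :=
  memLp_one_iff_integrable.1 (hf 1 (by simp))

theorem AllMoments.const [IsFiniteMeasure μ] (c : ℝ) : AllMoments (fun _ : Ω => c) μ :=
  fun _ _ => memLp_const c

theorem AllMoments.add (hf : AllMoments f μ) (hg : AllMoments g μ) :
    AllMoments (fun x => f x + g x) μ := fun p hp => (hf p hp).add (hg p hp)

/-- Hölder with exponents `2p, 2p, p`; requiring every finite order is what closes the class under
products. -/
theorem AllMoments.mul (hf : AllMoments f μ) (hg : AllMoments g μ) :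
    AllMoments (fun x => f x * g x) μ := by
  intro p hp
  have h2 : p * 2 ≠ ∞ := ENNReal.mul_ne_top hp (by simp)
  have : ENNReal.HolderTriple (p * 2) (p * 2) p := by
    constructor
    rw [ENNReal.mul_inv (Or.inr (by simp)) (Or.inr (by simp)), ← mul_add, ENNReal.inv_two_add_inv_two,
      mul_one]
  exact (hg (p * 2) h2).mul' (hf (p * 2) h2)

theorem AllMoments.const_mul (hf : AllMoments f μ) (c : ℝ) :
    AllMoments (fun x => c * f x) μ := fun p hp => (hf p hp).const_mul c

theorem AllMoments.pow [IsFiniteMeasure μ] (hf : AllMoments f μ) (k : ℕ) :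
    AllMoments (fun x => f x ^ k) μ := by
  induction k with
  | zero => simpa using AllMoments.const (μ := μ) 1
  | succ k ih => simpa only [pow_succ] using ih.mul hf

theorem AllMoments.abs (hf : AllMoments f μ) : AllMoments (fun x => |f x|) μ :=
  fun p hp => (hf p hp).abs

theorem AllMoments.sum {ι : Type*} {F : ι → Ω → ℝ} (s : Finset ι)
    (hF : ∀ i ∈ s, AllMoments (F i) μ) : AllMoments (fun x => ∑ i ∈ s, F i x) μ :=
  fun p hp => memLp_finsetSum s fun i hi => hF i hi p hp

theorem AllMoments.prod [IsFiniteMeasure μ] {ι : Type*} {F : ι → Ω → ℝ} (s : Finset ι)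
    (hF : ∀ i ∈ s, AllMoments (F i) μ) : AllMoments (fun x => ∏ i ∈ s, F i x) μ := by
  classical
  induction s using Finset.induction_on with
  | empty => simpa using AllMoments.const (μ := μ) 1
  | insert a s ha ih =>
    simp only [Finset.prod_insert ha]
    exact (hF a (by simp)).mul (ih fun i hi => hF i (by simp [hi]))

theorem AllMoments.polynomial [IsFiniteMeasure μ] (hf : AllMoments f μ) (p : Polynomial ℝ) :
    AllMoments (fun x => p.eval (f x)) μ := by
  simp only [Polynomial.eval_eq_sum_range]
  exact AllMoments.sum _ fun i _ => (hf.pow i).const_mul _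

theorem AllMoments.mvPolynomial [IsFiniteMeasure μ] {σ : Type*} {F : σ → Ω → ℝ}
    (hF : ∀ i, AllMoments (F i) μ) (p : MvPolynomial σ ℝ) :
    AllMoments (fun x => MvPolynomial.eval (fun i => F i x) p) μ := by
  simp only [MvPolynomial.eval_eq]
  exact AllMoments.sum _ fun d _ => (AllMoments.prod _ fun i _ => (hF i).pow _).const_mul _

theorem AllMoments.comp_measurePreserving {Ω' : Type*} [MeasurableSpace Ω'] {ν : Measure Ω'}
    (hf : AllMoments f μ) {φ : Ω' → Ω} (hφ : MeasurePreserving φ ν μ) :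
    AllMoments (fun x => f (φ x)) ν := fun p hp => (hf p hp).comp_measurePreserving hφ

end AllMoments

/-! ### Hermite polynomials and Gaussian integration by parts. -/

section Hermite

open Polynomial

/-- The probabilists' Hermite polynomials with real coefficients. -/
def hermiteReal (m : ℕ) : ℝ[X] := (hermite m).map (Int.castRingHom ℝ)

theorem hermiteReal_zero : hermiteReal 0 = 1 := by simp [hermiteReal]

theorem hermiteReal_succ (m : ℕ) :
    hermiteReal (m + 1) = X * hermiteReal m - derivative (hermiteReal m) := by
  simp [hermiteReal, hermite_succ, derivative_map]

theorem derivative_hermiteReal_succ (m : ℕ) :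
    derivative (hermiteReal (m + 1)) = (m + 1 : ℝ[X]) * hermiteReal m := by
  induction m with
  | zero => simp [hermiteReal_succ, hermiteReal_zero]
  | succ m ih =>
    have h := hermiteReal_succ m
    rw [hermiteReal_succ (m + 1), derivative_sub, derivative_mul, ih, derivative_mul, derivative_X,
      one_mul]
    have h1 : derivative ((m : ℝ[X]) + 1) = 0 := by simp
    rw [h1, h]
    push_cast
    ring

theorem derivative_hermiteReal (m : ℕ) :
    derivative (hermiteReal m) = (m : ℝ[X]) * hermiteReal (m - 1) := by
  cases m with
  | zero => simp [hermiteReal_zero]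
  | succ m => rw [derivative_hermiteReal_succ]; simp

theorem hermiteReal_monic (m : ℕ) : (hermiteReal m).Monic := (hermite_monic m).map _

theorem natDegree_hermiteReal (m : ℕ) : (hermiteReal m).natDegree = m := by
  rw [hermiteReal, (hermite_monic m).natDegree_map, natDegree_hermite]

/-- A polynomial is a linear combination of the Hermite polynomials up to its degree. -/
theorem exists_eq_sum_hermiteReal (m : ℕ) (p : ℝ[X]) (hp : p.natDegree ≤ m) :
    ∃ c : ℕ → ℝ, p = ∑ k ∈ Finset.range (m + 1), C (c k) * hermiteReal k := by
  induction m generalizing p with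
  | zero =>
    refine ⟨fun _ => p.coeff 0, ?_⟩
    simp [hermiteReal_zero, ← eq_C_of_natDegree_le_zero hp]
  | succ m ih =>
    have hq : (p - C (p.coeff (m + 1)) * hermiteReal (m + 1)).natDegree ≤ m := by
      rw [natDegree_le_iff_coeff_eq_zero]
      intro N hN
      rw [coeff_sub, coeff_C_mul]
      rcases Nat.lt_or_ge (m + 1) N with h | h
      · rw [coeff_eq_zero_of_natDegree_lt (hp.trans_lt h), coeff_eq_zero_of_natDegree_lt
          ((natDegree_hermiteReal _).trans_lt h)]
        simp
      · have : N = m + 1 := by omega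
        subst this
        have := (hermiteReal_monic (m + 1)).coeff_natDegree
        rw [natDegree_hermiteReal] at this
        rw [this]; ring
    obtain ⟨c, hc⟩ := ih _ hq
    refine ⟨fun k => if k = m + 1 then p.coeff (m + 1) else c k, ?_⟩
    rw [Finset.sum_range_succ]
    simp only [if_true]
    rw [Finset.sum_congr rfl (g := fun k => C (c k) * hermiteReal k), ← hc]
    · ring
    · intro k hk
      rw [if_neg (by have := Finset.mem_range.1 hk; omega)]

theorem allMoments_id_gaussianReal : AllMoments (fun x : ℝ => x) (gaussianReal 0 1) :=
  fun p hp => memLp_id_gaussianReal' p hp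

/-- Stein's identity: with `ρ` the Gaussian density, `(ρ p)' = ρ (p' - X p)` has integral zero. -/
theorem integral_X_mul_eq_integral_derivative (p : ℝ[X]) :
    ∫ x, x * p.eval x ∂(gaussianReal 0 1) = ∫ x, (derivative p).eval x ∂(gaussianReal 0 1) := by
  have hint : ∀ q : ℝ[X], Integrable (fun x => q.eval x) (gaussianReal 0 1) :=
    fun q => (allMoments_id_gaussianReal.polynomial q).integrable
  have hvol : ∀ q : ℝ[X], Integrable (fun x => gaussianPDFReal 0 1 x * q.eval x) := by
    intro q
    have := hint q
    rw [gaussianReal_of_var_ne_zero 0 one_ne_zero] at this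
    rw [integrable_withDensity_iff_integrable_smul' (measurable_gaussianPDF 0 1)
      (ae_of_all _ fun x => gaussianPDF_lt_top)] at this
    simpa [toReal_gaussianPDF] using this
  have hd : ∀ x : ℝ, HasDerivAt (fun x => gaussianPDFReal 0 1 x * p.eval x)
      (gaussianPDFReal 0 1 x * (derivative p - X * p).eval x) x := by
    intro x
    have h1 : HasDerivAt (gaussianPDFReal 0 1) (-x * gaussianPDFReal 0 1 x) x := by
      have h2 : HasDerivAt (fun x : ℝ => -(x - 0) ^ 2 / (2 * ((1 : NNReal) : ℝ))) (-x) x := by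
        have := (((hasDerivAt_id x).sub_const 0).pow 2).neg.div_const (2 * ((1 : NNReal) : ℝ))
        refine this.congr_deriv ?_
        simp
        ring
      have := h2.exp.const_mul (Real.sqrt (2 * Real.pi * ((1 : NNReal) : ℝ)))⁻¹
      rw [gaussianPDFReal_def]
      refine this.congr_deriv ?_
      ring
    refine (h1.mul (p.hasDerivAt x)).congr_deriv ?_
    simp only [eval_sub, eval_mul, eval_X]
    ring
  have h0 := integral_eq_zero_of_hasDerivAt_of_integrable hd (hvol _) (hvol _)
  have h1 : ∫ x, (derivative p - X * p).eval x ∂(gaussianReal 0 1) = 0 := by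
    rw [integral_gaussianReal_eq_integral_smul one_ne_zero]
    simpa only [smul_eq_mul] using h0
  have h2 := hint (X * p)
  simp only [eval_sub, eval_mul, eval_X] at h1 h2
  rw [integral_sub (hint _) h2] at h1
  linarith

/-- The Gaussian pairing of a Hermite polynomial with a translated Hermite polynomial. -/
theorem integral_hermiteReal_mul_shift (b m : ℕ) (t : ℝ) :
    ∫ z, (hermiteReal b).eval z * (hermiteReal m).eval (t + z) ∂(gaussianReal 0 1) =
      (m.descFactorial b : ℝ) * t ^ (m - b) := by
  have hshift : ∀ m, ∀ z : ℝ, (hermiteReal m).eval (t + z) =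
      ((hermiteReal m).comp (C t + X)).eval z := by intro m z; simp
  have hint : ∀ q : ℝ[X], Integrable (fun x => q.eval x) (gaussianReal 0 1) :=
    fun q => (allMoments_id_gaussianReal.polynomial q).integrable
  have hder : ∀ m, derivative ((hermiteReal m).comp (C t + X)) =
      (m : ℝ[X]) * (hermiteReal (m - 1)).comp (C t + X) := by
    intro m
    rw [derivative_comp, derivative_hermiteReal]
    simp
  -- By Stein's identity, raising the Hermite index is adjoint to differentiation.
  have hb : ∀ (b : ℕ) (q : ℝ[X]), ∫ z, (hermiteReal (b + 1)).eval z * q.eval z ∂(gaussianReal 0 1) =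
      ∫ z, (hermiteReal b).eval z * (derivative q).eval z ∂(gaussianReal 0 1) := by
    intro b q
    have h := integral_X_mul_eq_integral_derivative (hermiteReal b * q)
    have h1 : ∀ z : ℝ, (hermiteReal (b + 1)).eval z * q.eval z =
        z * (hermiteReal b * q).eval z - (derivative (hermiteReal b) * q).eval z := by
      intro z; rw [hermiteReal_succ]; simp; ring
    simp only [h1]
    have hi := hint (X * (hermiteReal b * q))
    simp only [eval_mul (p := X), eval_X] at hi
    rw [integral_sub hi (hint _), h, derivative_mul]
    simp only [eval_add]
    rw [integral_add (hint _) (hint _)]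
    simp
  -- Each step in `b` differentiates the shifted polynomial once, leaving `E[H_m(t + Z)] = t^m` for
  -- `b = 0`. If `m < b` the falling factorial vanishes, so the truncated exponent `m - b` is
  -- harmless.
  induction b generalizing m with
  | zero =>
    simp only [hermiteReal_zero, eval_one, one_mul, Nat.descFactorial_zero, Nat.cast_one, tsub_zero]
    induction m with
    | zero => simp [hermiteReal_zero]
    | succ m ih =>
      have h := integral_X_mul_eq_integral_derivative ((hermiteReal m).comp (C t + X))
      have h1 : ∀ z : ℝ, (hermiteReal (m + 1)).eval (t + z) =
          t * (hermiteReal m).eval (t + z) + (z * ((hermiteReal m).comp (C t + X)).eval z -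
            (derivative ((hermiteReal m).comp (C t + X))).eval z) := by
        intro z; rw [hermiteReal_succ, derivative_comp]; simp; ring
      simp only [h1]
      have hi := hint (X * (hermiteReal m).comp (C t + X))
      simp only [eval_mul (p := X), eval_X] at hi
      rw [integral_add (g := fun z => z * ((hermiteReal m).comp (C t + X)).eval z -
        (derivative ((hermiteReal m).comp (C t + X))).eval z) _ (hi.sub (hint _)),
        integral_sub hi (hint _), h, sub_self, add_zero, integral_const_mul, ih, pow_succ]
      · ring
      · simp only [hshift]; exact (hint _).const_mul t
  | succ b ih =>
    simp only [hshift]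
    rw [hb, hder]
    cases m with
    | zero => simp
    | succ m =>
      have := ih m
      simp only [hshift] at this
      simp only [add_tsub_cancel_right, eval_mul, eval_natCast]
      rw [Nat.succ_descFactorial_succ, show m + 1 - (b + 1) = m - b by omega, Nat.cast_mul, mul_assoc,
        ← this, ← integral_const_mul]
      congr 1; ext z; ring

end Hermite

/-! ### Multivariate Hermite polynomials and the dual certificate. -/

/-- The multi-indices of total degree at most `D`. -/
def degreeLE (n D : ℕ) : Finset (Fin n → ℕ) :=
  (Fintype.piFinset fun _ => Finset.range (D + 1)).filter fun β => ∑ j, β j ≤ D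

theorem mem_degreeLE {n D : ℕ} {β : Fin n → ℕ} : β ∈ degreeLE n D ↔ ∑ j, β j ≤ D := by
  simp only [degreeLE, Finset.mem_filter, Fintype.mem_piFinset, Finset.mem_range,
    and_iff_right_iff_imp]
  intro h j
  exact Nat.lt_succ_of_le ((Finset.single_le_sum (fun _ _ => Nat.zero_le _)
    (Finset.mem_univ j)).trans h)

/-- The multivariate Hermite polynomial, as a function. -/
def hermiteProd {n : ℕ} (β : Fin n → ℕ) (z : Fin n → ℝ) : ℝ :=
  ∏ j, (hermiteReal (β j)).eval (z j)

/-- The standard Gaussian measure on `ℝ^n`. -/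
abbrev stdGaussian (n : ℕ) : Measure (Fin n → ℝ) := Measure.pi fun _ => gaussianReal 0 1

theorem prod_pow_add_single {n : ℕ} (x : Fin n → ℝ) (α : Fin n → ℕ) (i : Fin n) :
    ∏ j, x j ^ (α + Pi.single i 1 : Fin n → ℕ) j = (∏ j, x j ^ α j) * x i := by
  simp only [Pi.add_apply, pow_add, Finset.prod_mul_distrib]
  congr 1
  rw [Finset.prod_eq_single i]
  · simp
  · intro j _ hj; simp [hj]
  · simp

theorem integral_hermiteProd_mul_shift {n : ℕ} (β m : Fin n → ℕ) (t : Fin n → ℝ) :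
    ∫ z, hermiteProd β z * hermiteProd m (fun j => t j + z j) ∂(stdGaussian n) =
      ∏ j, (((m j).descFactorial (β j) : ℕ) : ℝ) * t j ^ (m j - β j) := by
  simp only [hermiteProd, ← Finset.prod_mul_distrib]
  rw [integral_fintype_prod_eq_prod
    (fun j (z : ℝ) => (hermiteReal (β j)).eval z * (hermiteReal (m j)).eval (t j + z))]
  simp only [integral_hermiteReal_mul_shift]

theorem allMoments_stdGaussian {n : ℕ} (j : Fin n) :
    AllMoments (fun z : Fin n → ℝ => z j) (stdGaussian n) :=
  allMoments_id_gaussianReal.comp_measurePreserving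
    (measurePreserving_eval (fun _ => gaussianReal 0 1) j)

theorem AllMoments.hermiteProd {Ω : Type*} [MeasurableSpace Ω] {μ : Measure Ω} [IsFiniteMeasure μ]
    {n : ℕ} {F : Fin n → Ω → ℝ} (hF : ∀ j, AllMoments (F j) μ) (β : Fin n → ℕ) :
    AllMoments (fun ω => GAM.hermiteProd β fun j => F j ω) μ :=
  AllMoments.prod _ fun j _ => (hF j).polynomial _

/-- The weight of the Hermite polynomial of index `β` in the dual certificate. -/
def dualWeight {n : ℕ} (μ : Measure (Fin n → ℝ)) (i : Fin n) (lam : ℝ) (β : Fin n → ℕ) : ℝ :=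
  cumulant μ (β + Pi.single i 1) * Real.sqrt lam ^ (∑ j, β j) / ((∏ j, (β j).factorial : ℕ) : ℝ)

/-- A polynomial of the noise that has the same correlation with low-degree polynomials of the
observation as the `i`-th coordinate of the signal. -/
def dualCertificate {n : ℕ} (μ : Measure (Fin n → ℝ)) (D : ℕ) (i : Fin n) (lam : ℝ)
    (z : Fin n → ℝ) : ℝ :=
  ∑ β ∈ degreeLE n D, dualWeight μ i lam β * hermiteProd β z

/-- This is Hermite orthogonality, read off from the shift formula at `t = 0`. Where `m j < β j` the
power is `0 ^ 0 = 1`, and it is the falling factorial that vanishes. -/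
theorem prod_descFactorial_mul_zero_pow {n : ℕ} (β m : Fin n → ℕ) :
    ∏ j, (((m j).descFactorial (β j) : ℕ) : ℝ) * (0 : ℝ) ^ (m j - β j) =
      if m = β then ((∏ j, (β j).factorial : ℕ) : ℝ) else 0 := by
  split_ifs with h
  · subst h; simp [Nat.descFactorial_self]
  · obtain ⟨j, hj⟩ := Function.ne_iff.1 h
    apply Finset.prod_eq_zero (Finset.mem_univ j)
    rcases lt_or_gt_of_ne hj with h | h
    · simp [Nat.descFactorial_eq_zero_iff_lt.2 h]
    · rw [zero_pow (by omega), mul_zero]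

/-- Parseval in the Hermite basis, where `H_β` has squared norm `β!`. -/
theorem integral_dualCertificate_sq {n : ℕ} (μ : Measure (Fin n → ℝ)) (D : ℕ) (i : Fin n)
    {lam : ℝ} (hlam : 0 ≤ lam) :
    ∫ z, dualCertificate μ D i lam z ^ 2 ∂(stdGaussian n) =
      ∑ β ∈ degreeLE n D, cumulant μ (β + Pi.single i 1) ^ 2 * lam ^ (∑ j, β j) /
        ((∏ j, (β j).factorial : ℕ) : ℝ) := by
  have hint : ∀ β m : Fin n → ℕ,
      Integrable (fun z => hermiteProd β z * hermiteProd m z) (stdGaussian n) := fun β m =>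
    ((AllMoments.hermiteProd allMoments_stdGaussian β).mul
      (AllMoments.hermiteProd allMoments_stdGaussian m)).integrable
  have horth : ∀ β m : Fin n → ℕ, ∫ z, hermiteProd β z * hermiteProd m z ∂(stdGaussian n) =
      if m = β then ((∏ j, (β j).factorial : ℕ) : ℝ) else 0 := by
    intro β m
    have := integral_hermiteProd_mul_shift β m 0
    simp only [Pi.zero_apply, zero_add] at this
    rw [this, prod_descFactorial_mul_zero_pow]
  have hexp : ∀ z : Fin n → ℝ, dualCertificate μ D i lam z ^ 2 = ∑ β ∈ degreeLE n D,
      ∑ m ∈ degreeLE n D, dualWeight μ i lam β * dualWeight μ i lam m *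
        (hermiteProd β z * hermiteProd m z) := by
    intro z
    rw [dualCertificate, sq, Finset.sum_mul_sum]
    refine Finset.sum_congr rfl fun β _ => Finset.sum_congr rfl fun m _ => ?_
    ring
  simp only [hexp]
  rw [integral_finsetSum _ fun β _ => integrable_finsetSum _ fun m _ => (hint β m).const_mul _]
  refine Finset.sum_congr rfl fun β hβ => ?_
  rw [integral_finsetSum _ fun m _ => (hint β m).const_mul _]
  simp only [integral_const_mul, horth, mul_ite, mul_zero]
  rw [Finset.sum_ite_eq' _ β, if_pos hβ, dualWeight]
  have hpos : ((∏ j, (β j).factorial : ℕ) : ℝ) ≠ 0 := by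
    rw [Nat.cast_ne_zero]
    exact Finset.prod_ne_zero_iff.2 fun j _ => Nat.factorial_ne_zero _
  have hs : lam ^ (∑ j, β j) = (Real.sqrt lam ^ (∑ j, β j)) ^ 2 := by
    rw [← pow_mul, mul_comm, pow_mul, Real.sq_sqrt hlam]
  rw [hs]
  field_simp

/-! ### Duality: the low-degree correlation is bounded by cumulants. -/

section Duality

theorem allMoments_signal {n : ℕ} {μ : Measure (Fin n → ℝ)}
    (hX : ∀ j, AllMoments (fun x : Fin n → ℝ => x j) μ) (j : Fin n) :
    AllMoments (fun w : (Fin n → ℝ) × (Fin n → ℝ) => w.1 j) (signalNoise μ) :=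
  (hX j).comp_measurePreserving measurePreserving_fst

variable {n : ℕ} {μ : Measure (Fin n → ℝ)} [IsProbabilityMeasure μ]

theorem allMoments_noise (j : Fin n) :
    AllMoments (fun w : (Fin n → ℝ) × (Fin n → ℝ) => w.2 j) (signalNoise μ) :=
  (allMoments_stdGaussian j).comp_measurePreserving measurePreserving_snd

instance : IsProbabilityMeasure (signalNoise μ) := by
  unfold signalNoise; infer_instance

theorem allMoments_observation (hX : ∀ j, AllMoments (fun x : Fin n → ℝ => x j) μ) (lam : ℝ)
    (j : Fin n) : AllMoments (fun w => observation lam w j) (signalNoise μ) :=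
  ((allMoments_signal hX j).const_mul _).add (allMoments_noise j)

theorem allMoments_dualCertificate (D : ℕ) (i : Fin n) (lam : ℝ) :
    AllMoments (fun w : (Fin n → ℝ) × (Fin n → ℝ) => dualCertificate μ D i lam w.2)
      (signalNoise μ) :=
  AllMoments.sum _ fun β _ => (AllMoments.hermiteProd allMoments_noise β).const_mul _

/-- The substitution `β ↦ α - β` makes `β` index the cumulant, matching the coefficient of `H_β` in
the certificate. -/
theorem moment_eq_sum (α : Fin n → ℕ) (i : Fin n) :
    moment μ (α + Pi.single i 1) = ∑ β ∈ Finset.Iic α, ((∏ k, (α k).choose (β k) : ℕ) : ℝ) *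
      (cumulant μ (β + Pi.single i 1) * moment μ (α - β)) := by
  rw [moment_add_single]
  refine Finset.sum_bij' (fun β _ => α - β) (fun β _ => α - β) ?_ ?_ ?_ ?_ ?_
  · intro β _; simp
  · intro β _; simp
  · intro β hβ; exact tsub_tsub_cancel_of_le (Finset.mem_Iic.1 hβ)
  · intro β hβ; exact tsub_tsub_cancel_of_le (Finset.mem_Iic.1 hβ)
  · intro β hβ
    have hβ' := Finset.mem_Iic.1 hβ
    rw [tsub_tsub_cancel_of_le hβ']
    congr 2
    refine Finset.prod_congr rfl fun k _ => ?_
    exact (Nat.choose_symm (hβ' k)).symm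

/-- Given the signal, the observation is the noise shifted by `√lam X`, so the shift formula applies
under the outer integral. -/
theorem integral_hermiteProd_observation (hX : ∀ j, AllMoments (fun x : Fin n → ℝ => x j) μ)
    (lam : ℝ) (β m : Fin n → ℕ) :
    ∫ w, hermiteProd β w.2 * hermiteProd m (observation lam w) ∂(signalNoise μ) =
      ((∏ j, (m j).descFactorial (β j) : ℕ) : ℝ) *
        (Real.sqrt lam ^ (∑ j, (m j - β j)) * moment μ (m - β)) := by
  have hint := ((AllMoments.hermiteProd (allMoments_noise (μ := μ)) β).mul
    (AllMoments.hermiteProd (allMoments_observation hX lam) m)).integrable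
  rw [signalNoise] at hint ⊢
  rw [integral_prod _ hint]
  simp only [observation]
  simp only [integral_hermiteProd_mul_shift β m (fun j => Real.sqrt lam * _), mul_pow]
  simp only [Finset.prod_mul_distrib, Finset.prod_pow_eq_pow_sum]
  rw [integral_const_mul, integral_const_mul, moment]
  push_cast
  rfl

theorem integral_signal_mul_hermiteProd_observation
    (hX : ∀ j, AllMoments (fun x : Fin n → ℝ => x j) μ) (lam : ℝ) (i : Fin n) (m : Fin n → ℕ) :
    ∫ w, w.1 i * hermiteProd m (observation lam w) ∂(signalNoise μ) =
      Real.sqrt lam ^ (∑ j, m j) * moment μ (m + Pi.single i 1) := by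
  have hint := ((allMoments_signal hX i).mul
    (AllMoments.hermiteProd (allMoments_observation hX lam) m)).integrable
  rw [signalNoise] at hint ⊢
  rw [integral_prod _ hint]
  simp only [observation]
  have h0 : ∀ x : Fin n → ℝ, ∫ z, hermiteProd m (fun j => Real.sqrt lam * x j + z j)
      ∂(stdGaussian n) = ∏ j, (Real.sqrt lam * x j) ^ m j := by
    intro x
    have := integral_hermiteProd_mul_shift 0 m (fun j => Real.sqrt lam * x j)
    simpa [hermiteProd, hermiteReal_zero] using this
  simp only [integral_const_mul, h0, mul_pow, Finset.prod_mul_distrib, Finset.prod_pow_eq_pow_sum]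
  rw [moment, ← integral_const_mul]
  congr 1
  ext x
  rw [prod_pow_add_single]; ring

/-- The factor `1/β!` in `dualWeight` turns falling factorials into binomial coefficients, and the
powers of `√lam` combine to degree `|m|`; what remains is `moment_eq_sum`. -/
theorem integral_dualCertificate_mul_hermiteProd
    (hX : ∀ j, AllMoments (fun x : Fin n → ℝ => x j) μ) (lam : ℝ) (i : Fin n) {D : ℕ}
    {m : Fin n → ℕ} (hm : ∑ j, m j ≤ D) :
    ∫ w, dualCertificate μ D i lam w.2 * hermiteProd m (observation lam w) ∂(signalNoise μ) =
      ∫ w, w.1 i * hermiteProd m (observation lam w) ∂(signalNoise μ) := by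
  have hint : ∀ β : Fin n → ℕ, Integrable (fun w : (Fin n → ℝ) × (Fin n → ℝ) =>
      hermiteProd β w.2 * hermiteProd m (observation lam w)) (signalNoise μ) := fun β =>
    ((AllMoments.hermiteProd (allMoments_noise (μ := μ)) β).mul
    (AllMoments.hermiteProd (allMoments_observation hX lam) m)).integrable
  simp only [dualCertificate, Finset.sum_mul, mul_assoc]
  rw [integral_finsetSum _ fun β _ => (hint β).const_mul _]
  simp only [integral_const_mul, integral_hermiteProd_observation hX,
    integral_signal_mul_hermiteProd_observation hX]
  rw [moment_eq_sum, Finset.mul_sum]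
  symm
  have hsub : Finset.Iic m ⊆ degreeLE n D := fun β hβ =>
    mem_degreeLE.2 ((Finset.sum_le_sum fun j _ => Finset.mem_Iic.1 hβ j).trans hm)
  rw [← Finset.sum_subset hsub]
  · refine Finset.sum_congr rfl fun β hβ => ?_
    have hβ' := Finset.mem_Iic.1 hβ
    have hfac : ∏ j, (m j).descFactorial (β j) =
        (∏ j, (β j).factorial) * ∏ j, (m j).choose (β j) := by
      rw [← Finset.prod_mul_distrib]
      exact Finset.prod_congr rfl fun j _ => Nat.descFactorial_eq_factorial_mul_choose _ _
    have hdeg : ∑ j, m j = ∑ j, β j + ∑ j, (m j - β j) := by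
      rw [← Finset.sum_add_distrib]
      exact Finset.sum_congr rfl fun j _ => by have : β j ≤ m j := hβ' j; omega
    have hpos : ((∏ j, (β j).factorial : ℕ) : ℝ) ≠ 0 := by
      rw [Nat.cast_ne_zero]
      exact Finset.prod_ne_zero_iff.2 fun j _ => Nat.factorial_ne_zero _
    rw [dualWeight, hfac, hdeg, pow_add, Nat.cast_mul]
    field_simp
  -- Indices `β` not below `m` contribute nothing, since some falling factorial is zero.
  · intro β _ hβ
    have : ¬ β ≤ m := fun h => hβ (Finset.mem_Iic.2 h)
    rw [Pi.le_def, not_forall] at this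
    obtain ⟨j, hj⟩ := this
    have h0 : ∏ j, (m j).descFactorial (β j) = 0 :=
      Finset.prod_eq_zero (Finset.mem_univ j) (Nat.descFactorial_eq_zero_iff_lt.2 (not_le.1 hj))
    simp [h0]

theorem prod_pow_eq_sum_hermiteProd (d : Fin n → ℕ) :
    ∃ (s : Finset (Fin n → ℕ)) (c : (Fin n → ℕ) → ℝ), (∀ m ∈ s, ∑ j, m j ≤ ∑ j, d j) ∧
      ∀ y : Fin n → ℝ, ∏ j, y j ^ d j = ∑ m ∈ s, c m * hermiteProd m y := by
  have h : ∀ j, ∃ c : ℕ → ℝ, (Polynomial.X ^ d j : Polynomial ℝ) =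
      ∑ k ∈ Finset.range (d j + 1), Polynomial.C (c k) * hermiteReal k := fun j =>
    exists_eq_sum_hermiteReal (d j) _ (by simp)
  choose c hc using h
  refine ⟨Fintype.piFinset fun j => Finset.range (d j + 1), fun m => ∏ j, c j (m j), ?_, ?_⟩
  · intro m hm
    refine Finset.sum_le_sum fun j _ => ?_
    have := Finset.mem_range.1 (Fintype.mem_piFinset.1 hm j)
    omega
  · intro y
    have : ∀ j, y j ^ d j = ∑ k ∈ Finset.range (d j + 1), c j k * (hermiteReal k).eval (y j) := by
      intro j
      have := congrArg (Polynomial.eval (y j)) (hc j)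
      simpa [Polynomial.eval_finsetSum] using this
    simp only [this, Finset.prod_univ_sum, hermiteProd, Finset.prod_mul_distrib]

theorem integral_dualCertificate_mul_eval
    (hX : ∀ j, AllMoments (fun x : Fin n → ℝ => x j) μ) (lam : ℝ) (i : Fin n) {D : ℕ}
    (g : MvPolynomial (Fin n) ℝ) (hg : g.totalDegree ≤ D) :
    ∫ w, dualCertificate μ D i lam w.2 * MvPolynomial.eval (observation lam w) g
        ∂(signalNoise μ) =
      ∫ w, w.1 i * MvPolynomial.eval (observation lam w) g ∂(signalNoise μ) := by
  have hY := allMoments_observation hX lam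
  have hexp : ∀ d ∈ g.support, ∃ (s : Finset (Fin n → ℕ)) (c : (Fin n → ℕ) → ℝ),
      (∀ m ∈ s, ∑ j, m j ≤ D) ∧
      ∀ y : Fin n → ℝ, ∏ j, y j ^ d j = ∑ m ∈ s, c m * hermiteProd m y := by
    intro d hd
    obtain ⟨s, c, h1, h2⟩ := prod_pow_eq_sum_hermiteProd d
    refine ⟨s, c, fun m hm => (h1 m hm).trans ?_, h2⟩
    have := (MvPolynomial.le_totalDegree hd).trans hg
    rwa [Finsupp.sum_fintype _ _ (fun _ => rfl)] at this
  choose! s c hs hc using hexp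
  have heval : ∀ y : Fin n → ℝ, MvPolynomial.eval y g =
      ∑ d ∈ g.support, ∑ m ∈ s d, (g.coeff d * c d m) * hermiteProd m y := by
    intro y
    rw [MvPolynomial.eval_eq']
    refine Finset.sum_congr rfl fun d hd => ?_
    rw [hc d hd, Finset.mul_sum]
    exact Finset.sum_congr rfl fun m _ => by ring
  have hlin : ∀ U : (Fin n → ℝ) × (Fin n → ℝ) → ℝ, AllMoments U (signalNoise μ) →
      ∫ w, U w * MvPolynomial.eval (observation lam w) g ∂(signalNoise μ) =
      ∑ d ∈ g.support, ∑ m ∈ s d, (g.coeff d * c d m) *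
        ∫ w, U w * hermiteProd m (observation lam w) ∂(signalNoise μ) := by
    intro U hU
    have hint : ∀ m a, Integrable (fun w => a * (U w * hermiteProd m (observation lam w)))
        (signalNoise μ) := fun m a => ((hU.mul (AllMoments.hermiteProd hY m)).const_mul a).integrable
    simp only [heval, Finset.mul_sum]
    simp only [mul_left_comm (U _)]
    rw [integral_finsetSum _ fun d _ => integrable_finsetSum _ fun m _ => hint m _]
    refine Finset.sum_congr rfl fun d _ => ?_
    rw [integral_finsetSum _ fun m _ => hint m _]
    exact Finset.sum_congr rfl fun m _ => integral_const_mul _ _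
  rw [hlin _ (allMoments_dualCertificate D i lam), hlin _ (allMoments_signal hX i)]
  refine Finset.sum_congr rfl fun d hd => Finset.sum_congr rfl fun m hm => ?_
  rw [integral_dualCertificate_mul_hermiteProd hX lam i (hs d hd m hm)]

/-- The cumulant bound on the low-degree correlation. -/
theorem corr_sq_le (hX : ∀ j, AllMoments (fun x : Fin n → ℝ => x j) μ) (D : ℕ) {lam : ℝ}
    (hlam : 0 ≤ lam) :
    corr μ D lam ^ 2 ≤ ∑ i : Fin n, ∑ β ∈ degreeLE n D,
      cumulant μ (β + Pi.single i 1) ^ 2 * lam ^ (∑ j, β j) /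
        ((∏ j, (β j).factorial : ℕ) : ℝ) := by
  rw [corr, Real.sq_sqrt]
  · refine Finset.sum_le_sum fun i _ => ?_
    rw [← integral_dualCertificate_sq μ D i hlam]
    refine Real.sSup_le ?_ (integral_nonneg fun _ => sq_nonneg _)
    rintro r ⟨g, hg, hnorm, rfl⟩
    have hW := allMoments_dualCertificate (μ := μ) D i lam
    have hG := AllMoments.mvPolynomial (allMoments_observation hX lam) g
    have hsnd : ∫ z, dualCertificate μ D i lam z ^ 2 ∂(stdGaussian n) =
        ∫ w, dualCertificate μ D i lam w.2 ^ 2 ∂(signalNoise μ) := by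
      rw [signalNoise, integral_fun_snd (fun z => dualCertificate μ D i lam z ^ 2)]
      simp
    rw [hsnd]
    set c := ∫ w, MvPolynomial.eval (observation lam w) g * w.1 i ∂(signalNoise μ) with hc
    have hc' : ∫ w, dualCertificate μ D i lam w.2 * MvPolynomial.eval (observation lam w) g
        ∂(signalNoise μ) = c := by
      rw [integral_dualCertificate_mul_eval hX lam i g hg, hc]
      simp only [mul_comm]
    -- Cauchy-Schwarz: since `E[g(Y)²] = 1` and `E[W g(Y)] = c`, this integral equals `E[W²] - c²`.
    have h0 : 0 ≤ ∫ w, (dualCertificate μ D i lam w.2 -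
        c * MvPolynomial.eval (observation lam w) g) ^ 2 ∂(signalNoise μ) :=
      integral_nonneg fun _ => sq_nonneg _
    have hexp : ∀ w, (dualCertificate μ D i lam w.2 -
        c * MvPolynomial.eval (observation lam w) g) ^ 2 = dualCertificate μ D i lam w.2 ^ 2 +
        ((-(2 * c)) * (dualCertificate μ D i lam w.2 * MvPolynomial.eval (observation lam w) g) +
        c ^ 2 * MvPolynomial.eval (observation lam w) g ^ 2) := fun w => by ring
    have i1 := (hW.pow 2).integrable
    have i2 := ((hW.mul hG).const_mul (-(2 * c))).integrable
    have i3 := ((hG.pow 2).const_mul (c ^ 2)).integrable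
    simp only [hexp] at h0
    have i23 := i2.add i3
    simp only [Pi.add_def] at i23
    rw [integral_add i1 i23, integral_add i2 i3, integral_const_mul, integral_const_mul, hc',
      hnorm] at h0
    linarith
  · refine Finset.sum_nonneg fun i _ => Real.sSup_nonneg ?_
    rintro r ⟨g, _, _, rfl⟩
    exact sq_nonneg _

end Duality

/-! ### From cumulants to overlap moments. -/

/-- The product of the factorials of a multi-index. -/
def multiFactorial {n : ℕ} (α : Fin n → ℕ) : ℝ := ((∏ j, (α j).factorial : ℕ) : ℝ)

theorem multiFactorial_pos {n : ℕ} (α : Fin n → ℕ) : 0 < multiFactorial α := by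
  rw [multiFactorial, Nat.cast_pos]
  exact Finset.prod_pos fun j _ => Nat.factorial_pos _

theorem multinomial_eq_div {n : ℕ} {α : Fin n → ℕ} {k : ℕ} (hα : ∑ j, α j = k) :
    (Nat.multinomial Finset.univ α : ℝ) = (k.factorial : ℝ) / multiFactorial α := by
  rw [eq_div_iff (multiFactorial_pos α).ne', multiFactorial, ← hα, mul_comm, ← Nat.cast_mul,
    Nat.multinomial_spec]

theorem mem_piAntidiag_univ {n k : ℕ} {α : Fin n → ℕ} :
    α ∈ Finset.piAntidiag Finset.univ k ↔ ∑ j, α j = k := by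
  simp

section OverlapMoments

variable {n : ℕ} {μ : Measure (Fin n → ℝ)} [IsProbabilityMeasure μ]

instance : IsProbabilityMeasure (replicas μ) := by
  unfold replicas; infer_instance

theorem integral_replicas_mul_self (f : (Fin n → ℝ) → ℝ) :
    ∫ z, f z.1 * f z.2 ∂(replicas μ) = (∫ x, f x ∂μ) ^ 2 := by
  rw [replicas, integral_prod_mul f f, sq]

theorem allMoments_fst (hX : ∀ j, AllMoments (fun x : Fin n → ℝ => x j) μ) (j : Fin n) :
    AllMoments (fun z : (Fin n → ℝ) × (Fin n → ℝ) => z.1 j) (replicas μ) :=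
  (hX j).comp_measurePreserving measurePreserving_fst

theorem allMoments_snd (hX : ∀ j, AllMoments (fun x : Fin n → ℝ => x j) μ) (j : Fin n) :
    AllMoments (fun z : (Fin n → ℝ) × (Fin n → ℝ) => z.2 j) (replicas μ) :=
  (hX j).comp_measurePreserving measurePreserving_snd

theorem allMoments_overlap (hX : ∀ j, AllMoments (fun x : Fin n → ℝ => x j) μ) :
    AllMoments overlap (replicas μ) :=
  AllMoments.sum _ fun j _ => (allMoments_fst hX j).mul (allMoments_snd hX j)

theorem overlap_pow_eq_sum (z : (Fin n → ℝ) × (Fin n → ℝ)) (k : ℕ) :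
    overlap z ^ k = ∑ α ∈ Finset.piAntidiag Finset.univ k,
      (k.factorial : ℝ) / multiFactorial α * ((∏ j, z.1 j ^ α j) * ∏ j, z.2 j ^ α j) := by
  rw [overlap, Finset.sum_pow_eq_sum_piAntidiag]
  refine Finset.sum_congr rfl fun α hα => ?_
  rw [multinomial_eq_div (mem_piAntidiag_univ.1 hα)]
  simp only [mul_pow, Finset.prod_mul_distrib]

/-- The two draws are independent, so each monomial of the multinomial expansion has expectation
`moment μ α ^ 2`. -/
theorem integral_overlap_pow (hX : ∀ j, AllMoments (fun x : Fin n → ℝ => x j) μ) (k : ℕ) :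
    ∫ z, overlap z ^ k ∂(replicas μ) = (k.factorial : ℝ) *
      ∑ α ∈ Finset.piAntidiag Finset.univ k, moment μ α ^ 2 / multiFactorial α := by
  simp only [overlap_pow_eq_sum]
  rw [integral_finsetSum, Finset.mul_sum]
  · refine Finset.sum_congr rfl fun α _ => ?_
    rw [integral_const_mul, integral_replicas_mul_self (fun x => ∏ j, x j ^ α j), moment]
    ring
  · intro α _
    exact (((AllMoments.prod _ fun j _ => (allMoments_fst hX j).pow _).mul
      (AllMoments.prod _ fun j _ => (allMoments_snd hX j).pow _)).const_mul _).integrable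

/-- One factor of the overlap is kept out of the multinomial expansion, so that the sum over `i` and
the weights `1/α!` match those of the cumulant bound. -/
theorem integral_overlap_pow_succ (hX : ∀ j, AllMoments (fun x : Fin n → ℝ => x j) μ) (k : ℕ) :
    ∫ z, overlap z ^ (k + 1) ∂(replicas μ) = (k.factorial : ℝ) *
      ∑ i, ∑ α ∈ Finset.piAntidiag Finset.univ k,
        moment μ (α + Pi.single i 1) ^ 2 / multiFactorial α := by
  have h : ∀ z : (Fin n → ℝ) × (Fin n → ℝ), overlap z ^ (k + 1) =
      ∑ i, ∑ α ∈ Finset.piAntidiag Finset.univ k, (k.factorial : ℝ) / multiFactorial α *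
        ((∏ j, z.1 j ^ (α + Pi.single i 1 : Fin n → ℕ) j) *
          ∏ j, z.2 j ^ (α + Pi.single i 1 : Fin n → ℕ) j) := by
    intro z
    rw [pow_succ, overlap_pow_eq_sum, overlap, Finset.mul_sum]
    refine Finset.sum_congr rfl fun i _ => ?_
    rw [Finset.sum_mul]
    refine Finset.sum_congr rfl fun α _ => ?_
    rw [prod_pow_add_single, prod_pow_add_single]
    ring
  have hint : ∀ (i : Fin n) (α : Fin n → ℕ), Integrable (fun z : (Fin n → ℝ) × (Fin n → ℝ) =>
      (k.factorial : ℝ) / multiFactorial α *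
        ((∏ j, z.1 j ^ (α + Pi.single i 1 : Fin n → ℕ) j) *
          ∏ j, z.2 j ^ (α + Pi.single i 1 : Fin n → ℕ) j)) (replicas μ) := fun i α =>
    (((AllMoments.prod _ fun j _ => (allMoments_fst hX j).pow _).mul
      (AllMoments.prod _ fun j _ => (allMoments_snd hX j).pow _)).const_mul _).integrable
  simp only [h]
  rw [integral_finsetSum _ fun i _ => integrable_finsetSum _ fun α _ => hint i α, Finset.mul_sum]
  refine Finset.sum_congr rfl fun i _ => ?_
  rw [integral_finsetSum _ fun α _ => hint i α, Finset.mul_sum]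
  refine Finset.sum_congr rfl fun α _ => ?_
  rw [integral_const_mul]
  refine (congrArg _ (integral_replicas_mul_self (μ := μ)
    (fun x => ∏ j, x j ^ (α + Pi.single i 1 : Fin n → ℕ) j))).trans ?_
  rw [moment]
  ring

theorem moment_zero : moment μ 0 = 1 := by simp [moment]

theorem sum_add_single_apply (β : Fin n → ℕ) (i : Fin n) :
    ∑ j, (β + Pi.single i 1 : Fin n → ℕ) j = ∑ j, β j + 1 := by
  simp [Finset.sum_add_distrib]

/-- The recursion has nonnegative coefficients, so the sign passes to moments by induction on the
order. -/
theorem moment_nonneg_of_cumulant_nonneg {D : ℕ}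
    (hκ : ∀ α : Fin n → ℕ, ∑ i, α i ≤ D → 0 ≤ cumulant μ α) (α : Fin n → ℕ)
    (hα : ∑ i, α i ≤ D) : 0 ≤ moment μ α := by
  induction hk : ∑ i, α i using Nat.strong_induction_on generalizing α with
  | _ k ih =>
    subst hk
    by_cases h0 : α = 0
    · rw [h0, moment_zero]; exact zero_le_one
    · obtain ⟨i, hi⟩ := Function.ne_iff.1 h0
      simp only [Pi.zero_apply] at hi
      obtain ⟨α', rfl⟩ : ∃ α', α = α' + Pi.single i 1 := by
        refine ⟨α - Pi.single i 1, (tsub_add_cancel_of_le ?_).symm⟩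
        intro j
        by_cases hj : j = i
        · subst hj; simp; omega
        · simp [hj]
      rw [sum_add_single_apply] at hα ih
      rw [moment_eq_sum]
      refine Finset.sum_nonneg fun β hβ => ?_
      have hβ' := Finset.mem_Iic.1 hβ
      have h1 : ∑ j, β j ≤ ∑ j, α' j := Finset.sum_le_sum fun j _ => hβ' j
      have h2 : ∑ j, (α' - β) j ≤ ∑ j, α' j :=
        Finset.sum_le_sum fun j _ => by simp
      refine mul_nonneg (Nat.cast_nonneg _) (mul_nonneg (hκ _ ?_) (ih _ ?_ _ ?_ rfl))
      · rw [sum_add_single_apply]; omega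
      · omega
      · omega

theorem moment_add_single_eq (α : Fin n → ℕ) (i : Fin n) :
    moment μ (α + Pi.single i 1) = cumulant μ (α + Pi.single i 1) +
      ∑ β ∈ (Finset.Iic α).erase α, ((∏ k, (α k).choose (β k) : ℕ) : ℝ) *
        (cumulant μ (β + Pi.single i 1) * moment μ (α - β)) := by
  rw [moment_eq_sum, ← Finset.add_sum_erase _ _ (Finset.mem_Iic.2 le_rfl)]
  simp [moment_zero]

theorem sum_lt_of_mem_erase_Iic {α β : Fin n → ℕ} (h : β ∈ (Finset.Iic α).erase α) :
    ∑ j, β j < ∑ j, α j := by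
  obtain ⟨hne, hle⟩ := Finset.mem_erase.1 h
  have hle := Finset.mem_Iic.1 hle
  obtain ⟨j, hj⟩ := Function.ne_iff.1 hne
  exact Finset.sum_lt_sum (fun k _ => hle k) ⟨j, Finset.mem_univ _, lt_of_le_of_ne (hle j) hj⟩

theorem sum_sub_le (α β : Fin n → ℕ) : ∑ j, (α - β) j ≤ ∑ j, α j :=
  Finset.sum_le_sum fun j _ => by simp

theorem cumulant_le_moment {D : ℕ}
    (hκ : ∀ α : Fin n → ℕ, ∑ i, α i ≤ D → 0 ≤ cumulant μ α) (α : Fin n → ℕ) (i : Fin n)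
    (hα : ∑ i, α i + 1 ≤ D) : cumulant μ (α + Pi.single i 1) ≤ moment μ (α + Pi.single i 1) := by
  rw [moment_add_single_eq, le_add_iff_nonneg_right]
  refine Finset.sum_nonneg fun β hβ => ?_
  have h1 := sum_lt_of_mem_erase_Iic hβ
  refine mul_nonneg (Nat.cast_nonneg _) (mul_nonneg (hκ _ ?_)
    (moment_nonneg_of_cumulant_nonneg hκ _ ?_))
  · rw [sum_add_single_apply]; omega
  · have := sum_sub_le α β; omega

/-- For `|α| = D` the cumulant has order `D + 1` and no known sign, hence the absolute values. The
correction terms only involve cumulants of order at most `D`, each lying between `0` and its moment.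
-/
theorem abs_cumulant_le {D : ℕ}
    (hκ : ∀ α : Fin n → ℕ, ∑ i, α i ≤ D → 0 ≤ cumulant μ α) (α : Fin n → ℕ) (i : Fin n)
    (hα : ∑ i, α i ≤ D) :
    |cumulant μ (α + Pi.single i 1)| ≤ ∑ β ∈ Finset.Iic α, ((∏ k, (α k).choose (β k) : ℕ) : ℝ) *
      (|moment μ (β + Pi.single i 1)| * moment μ (α - β)) := by
  have h : cumulant μ (α + Pi.single i 1) = moment μ (α + Pi.single i 1) -
      ∑ β ∈ (Finset.Iic α).erase α, ((∏ k, (α k).choose (β k) : ℕ) : ℝ) *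
        (cumulant μ (β + Pi.single i 1) * moment μ (α - β)) := by
    rw [moment_add_single_eq]; ring
  rw [← Finset.add_sum_erase _ _ (Finset.mem_Iic.2 le_rfl), h]
  refine (abs_sub _ _).trans (add_le_add ?_ ?_)
  · simp [moment_zero]
  · refine (Finset.abs_sum_le_sum_abs _ _).trans (Finset.sum_le_sum fun β hβ => ?_)
    have h1 := sum_lt_of_mem_erase_Iic hβ
    have hs := sum_sub_le α β
    have hκβ := hκ (β + Pi.single i 1) (by rw [sum_add_single_apply]; omega)
    have hm := moment_nonneg_of_cumulant_nonneg hκ (α - β) (by omega)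
    have hle := cumulant_le_moment hκ β i (by omega)
    rw [abs_of_nonneg (mul_nonneg (Nat.cast_nonneg _) (mul_nonneg hκβ hm))]
    gcongr
    exact hle.trans (le_abs_self _)

theorem sum_prod_choose (α : Fin n → ℕ) :
    ∑ β ∈ Finset.Iic α, ((∏ k, (α k).choose (β k) : ℕ) : ℝ) = 2 ^ ∑ j, α j := by
  have : Finset.Iic α = Fintype.piFinset fun j => Finset.range (α j + 1) := by
    ext β; simp [Pi.le_def]
  rw [this, ← Nat.cast_sum, ← Finset.prod_univ_sum (fun j => Finset.range (α j + 1))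
    (fun j k => (α j).choose k)]
  simp only [Nat.sum_range_choose, Finset.prod_pow_eq_pow_sum]
  push_cast
  rfl

/-- Cauchy-Schwarz with binomial weights, whose total mass is `2^|α|`. -/
theorem cumulant_sq_le {D : ℕ}
    (hκ : ∀ α : Fin n → ℕ, ∑ i, α i ≤ D → 0 ≤ cumulant μ α) (α : Fin n → ℕ) (i : Fin n)
    (hα : ∑ i, α i ≤ D) :
    cumulant μ (α + Pi.single i 1) ^ 2 ≤ 2 ^ (∑ j, α j) *
      ∑ β ∈ Finset.Iic α, ((∏ k, (α k).choose (β k) : ℕ) : ℝ) *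
        (moment μ (β + Pi.single i 1) ^ 2 * moment μ (α - β) ^ 2) := by
  rw [← sum_prod_choose α, ← sq_abs]
  refine (pow_le_pow_left₀ (abs_nonneg _) (abs_cumulant_le hκ α i hα) 2).trans ?_
  refine Finset.sum_sq_le_sum_mul_sum_of_sq_le_mul _ (fun β _ => Nat.cast_nonneg _)
    (fun β _ => by positivity) fun β _ => ?_
  rw [mul_pow, mul_pow, sq_abs]
  exact le_of_eq (by ring)

/-- Dividing by `α!` splits the binomial weight into `1/β!` and `1/(α-β)!`. The bijection `(α, β) ↔
(β, α - β)` then gives a Cauchy product of the two overlap expansions. -/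
theorem sum_cumulant_sq_le (hX : ∀ j, AllMoments (fun x : Fin n → ℝ => x j) μ) {D : ℕ}
    (hκ : ∀ α : Fin n → ℕ, ∑ i, α i ≤ D → 0 ≤ cumulant μ α) {k : ℕ} (hk : k ≤ D) :
    ∑ i, ∑ α ∈ Finset.piAntidiag Finset.univ k,
        cumulant μ (α + Pi.single i 1) ^ 2 / multiFactorial α ≤
      2 ^ k * ∑ p ∈ Finset.HasAntidiagonal.antidiagonal k,
        ((∫ z, overlap z ^ (p.1 + 1) ∂(replicas μ)) / (p.1.factorial : ℝ)) *
          ((∫ z, overlap z ^ p.2 ∂(replicas μ)) / (p.2.factorial : ℝ)) := by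
  have hrhs : ∀ p : ℕ × ℕ, ((∫ z, overlap z ^ (p.1 + 1) ∂(replicas μ)) / (p.1.factorial : ℝ)) *
          ((∫ z, overlap z ^ p.2 ∂(replicas μ)) / (p.2.factorial : ℝ)) =
      ∑ i, ∑ β ∈ Finset.piAntidiag Finset.univ p.1, ∑ γ ∈ Finset.piAntidiag Finset.univ p.2,
        moment μ (β + Pi.single i 1) ^ 2 / multiFactorial β *
          (moment μ γ ^ 2 / multiFactorial γ) := by
    intro p
    rw [integral_overlap_pow_succ hX, integral_overlap_pow hX,
      mul_div_cancel_left₀ _ (Nat.cast_ne_zero.2 (Nat.factorial_ne_zero _)),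
      mul_div_cancel_left₀ _ (Nat.cast_ne_zero.2 (Nat.factorial_ne_zero _)), Finset.sum_mul]
    refine Finset.sum_congr rfl fun i _ => ?_
    rw [Finset.sum_mul_sum]
  simp only [hrhs]
  conv_rhs => rw [Finset.sum_comm, Finset.mul_sum]
  refine Finset.sum_le_sum fun i _ => ?_
  have hstep : ∀ α ∈ Finset.piAntidiag (Finset.univ : Finset (Fin n)) k,
      cumulant μ (α + Pi.single i 1) ^ 2 / multiFactorial α ≤ 2 ^ k * ∑ β ∈ Finset.Iic α,
        moment μ (β + Pi.single i 1) ^ 2 / multiFactorial β *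
          (moment μ (α - β) ^ 2 / multiFactorial (α - β)) := by
    intro α hα
    have hα := mem_piAntidiag_univ.1 hα
    rw [div_le_iff₀ (multiFactorial_pos α), mul_assoc, Finset.sum_mul, ← hα]
    refine (cumulant_sq_le hκ α i (hα.trans_le hk)).trans_eq ?_
    congr 1
    refine Finset.sum_congr rfl fun β hβ => ?_
    have hβ := Finset.mem_Iic.1 hβ
    have hf : multiFactorial α =
        ((∏ k, (α k).choose (β k) : ℕ) : ℝ) * (multiFactorial β * multiFactorial (α - β)) := by
      simp only [multiFactorial, ← Nat.cast_mul, ← Finset.prod_mul_distrib]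
      congr 1
      refine Finset.prod_congr rfl fun j _ => ?_
      rw [← mul_assoc]
      exact (Nat.choose_mul_factorial_mul_factorial (hβ j)).symm
    have h1 := (multiFactorial_pos β).ne'
    have h2 := (multiFactorial_pos (α - β)).ne'
    rw [hf]
    field_simp
  refine (Finset.sum_le_sum hstep).trans_eq ?_
  rw [← Finset.mul_sum]
  congr 1
  simp only [Finset.sum_sigma']
  refine Finset.sum_bij'
    (fun x _ => ⟨(∑ j, x.2 j, ∑ j, (x.1 - x.2) j), x.2, x.1 - x.2⟩)
    (fun y _ => ⟨y.2.1 + y.2.2, y.2.1⟩) ?_ ?_ ?_ ?_ ?_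
  · rintro ⟨α, β⟩ h
    simp only [Finset.mem_sigma, mem_piAntidiag_univ, Finset.mem_Iic] at h
    simp only [Finset.mem_sigma, mem_piAntidiag_univ, Finset.HasAntidiagonal.mem_antidiagonal, and_true]
    rw [← Finset.sum_add_distrib, ← h.1]
    exact Finset.sum_congr rfl fun j _ => Nat.add_sub_cancel' (h.2 j)
  · rintro ⟨⟨a, b⟩, β, γ⟩ h
    simp only [Finset.mem_sigma, mem_piAntidiag_univ, Finset.HasAntidiagonal.mem_antidiagonal] at h
    simp only [Finset.mem_sigma, mem_piAntidiag_univ, Finset.mem_Iic]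
    refine ⟨?_, fun j => by simp⟩
    simp only [Pi.add_apply, Finset.sum_add_distrib]
    omega
  · rintro ⟨α, β⟩ h
    simp only [Finset.mem_sigma, mem_piAntidiag_univ, Finset.mem_Iic] at h
    simp only [add_tsub_cancel_of_le h.2]
  · rintro ⟨⟨a, b⟩, β, γ⟩ h
    simp only [Finset.mem_sigma, mem_piAntidiag_univ, Finset.HasAntidiagonal.mem_antidiagonal] at h
    obtain ⟨_, rfl, rfl⟩ := h
    simp only [add_tsub_cancel_left]
  · rintro ⟨α, β⟩ h
    rfl

theorem sum_antidiagonal_inv_factorial (k : ℕ) :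
    ∑ p ∈ Finset.HasAntidiagonal.antidiagonal k, (1 / (p.1.factorial : ℝ)) * (1 / (p.2.factorial : ℝ)) =
      2 ^ k / (k.factorial : ℝ) := by
  have h := (Commute.all (1 : ℝ) 1).add_pow' k
  rw [show (1 : ℝ) + 1 = 2 by norm_num] at h
  rw [h, Finset.sum_div]
  refine Finset.sum_congr rfl fun p hp => ?_
  have hp := Finset.HasAntidiagonal.mem_antidiagonal.1 hp
  subst hp
  have := Nat.choose_mul_factorial_mul_factorial (Nat.le_add_right p.1 p.2)
  rw [Nat.add_sub_cancel_left] at this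
  have h' : ((p.1 + p.2).choose p.1 : ℝ) * p.1.factorial * p.2.factorial =
      (p.1 + p.2).factorial := by exact_mod_cast this
  rw [← h']
  have h1 : (p.1.factorial : ℝ) ≠ 0 := Nat.cast_ne_zero.2 (Nat.factorial_ne_zero _)
  have h2 : (p.2.factorial : ℝ) ≠ 0 := Nat.cast_ne_zero.2 (Nat.factorial_ne_zero _)
  have h3 : ((p.1 + p.2).choose p.1 : ℝ) ≠ 0 :=
    Nat.cast_ne_zero.2 (Nat.choose_pos (Nat.le_add_right _ _)).ne'
  simp only [one_pow, mul_one, nsmul_eq_mul]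
  field_simp

/-- If the overlap moments up to order `D + 1` are those of a variable bounded by `q`, up to a
constant factor, then the low-degree correlation is controlled by `q`. -/
theorem corr_sq_le_of_overlap_moments (hX : ∀ j, AllMoments (fun x : Fin n → ℝ => x j) μ) {D : ℕ}
    (hκ : ∀ α : Fin n → ℕ, ∑ i, α i ≤ D → 0 ≤ cumulant μ α) {q b lam : ℝ} (hq : 0 ≤ q)
    (hb : 0 ≤ b) (hlam : 0 ≤ lam)
    (hmom : ∀ m ≤ D + 1, ∫ z, overlap z ^ m ∂(replicas μ) ≤ b * q ^ m) :
    corr μ D lam ^ 2 ≤ b ^ 2 * q * Real.exp (4 * lam * q) := by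
  -- Odd overlap moments are nonnegative as well, being weighted sums of squares.
  have hnn : ∀ m, 0 ≤ ∫ z, overlap z ^ m ∂(replicas μ) := by
    intro m
    rw [integral_overlap_pow hX]
    exact mul_nonneg (Nat.cast_nonneg _) (Finset.sum_nonneg fun α _ =>
      div_nonneg (sq_nonneg _) (multiFactorial_pos α).le)
  -- The `4` combines the `2^k` from Cauchy-Schwarz with the `2^k` from summing `1/(a! b!)`. The
  -- moment order `p.1 + 1` gives the extra factor `q` and is why moments up to `D + 1` are needed.
  have hterm : ∀ k ∈ Finset.range (D + 1), lam ^ k *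
      ∑ i, ∑ α ∈ Finset.piAntidiag Finset.univ k,
        cumulant μ (α + Pi.single i 1) ^ 2 / multiFactorial α ≤
      b ^ 2 * q * ((4 * lam * q) ^ k / (k.factorial : ℝ)) := by
    intro k hk
    have hk : k ≤ D := Nat.lt_succ_iff.1 (Finset.mem_range.1 hk)
    have h1 := sum_cumulant_sq_le hX hκ hk
    have h2 : ∑ p ∈ Finset.HasAntidiagonal.antidiagonal k,
        ((∫ z, overlap z ^ (p.1 + 1) ∂(replicas μ)) / (p.1.factorial : ℝ)) *
          ((∫ z, overlap z ^ p.2 ∂(replicas μ)) / (p.2.factorial : ℝ)) ≤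
        ∑ p ∈ Finset.HasAntidiagonal.antidiagonal k, b ^ 2 * q ^ (k + 1) *
          ((1 / (p.1.factorial : ℝ)) * (1 / (p.2.factorial : ℝ))) := by
      refine Finset.sum_le_sum fun p hp => ?_
      have hp := Finset.HasAntidiagonal.mem_antidiagonal.1 hp
      have e1 := hmom (p.1 + 1) (by omega)
      have e2 := hmom p.2 (by omega)
      calc _ ≤ (b * q ^ (p.1 + 1) / (p.1.factorial : ℝ)) * (b * q ^ p.2 / (p.2.factorial : ℝ)) := by
            have := hnn p.2
            gcongr
        _ = _ := by rw [← hp]; ring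
    rw [← Finset.mul_sum, sum_antidiagonal_inv_factorial] at h2
    calc _ ≤ lam ^ k * (2 ^ k * (b ^ 2 * q ^ (k + 1) * (2 ^ k / (k.factorial : ℝ)))) := by
          gcongr
          exact h1.trans (by gcongr)
      _ = b ^ 2 * q * ((lam ^ k * (2 ^ k * 2 ^ k) * q ^ k) / (k.factorial : ℝ)) := by ring
      _ = _ := by rw [show 4 * lam * q = lam * (2 * 2) * q by ring, mul_pow, mul_pow, mul_pow]
  have hgroup : ∑ i : Fin n, ∑ β ∈ degreeLE n D,
      cumulant μ (β + Pi.single i 1) ^ 2 * lam ^ (∑ j, β j) /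
        ((∏ j, (β j).factorial : ℕ) : ℝ) = ∑ k ∈ Finset.range (D + 1), lam ^ k *
      ∑ i, ∑ α ∈ Finset.piAntidiag Finset.univ k,
        cumulant μ (α + Pi.single i 1) ^ 2 / multiFactorial α := by
    simp only [Finset.mul_sum]
    conv_rhs => rw [Finset.sum_comm]
    refine Finset.sum_congr rfl fun i _ => ?_
    rw [← Finset.sum_fiberwise_of_maps_to (g := fun β : Fin n → ℕ => ∑ j, β j)
      (t := Finset.range (D + 1))
      (fun β hβ => Finset.mem_range.2 (Nat.lt_succ_of_le (mem_degreeLE.1 hβ)))]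
    refine Finset.sum_congr rfl fun k hk => ?_
    have : (degreeLE n D).filter (fun β => ∑ j, β j = k) =
        Finset.piAntidiag Finset.univ k := by
      ext β
      rw [Finset.mem_filter, mem_degreeLE, mem_piAntidiag_univ]
      have := Finset.mem_range.1 hk
      constructor
      · exact fun h => h.2
      · intro h; exact ⟨by omega, h⟩
    rw [this]
    refine Finset.sum_congr rfl fun β hβ => ?_
    rw [mem_piAntidiag_univ.1 hβ, multiFactorial]
    ring
  refine (corr_sq_le hX D hlam).trans ?_
  rw [hgroup]
  refine (Finset.sum_le_sum hterm).trans ?_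
  rw [← Finset.mul_sum]
  have := Real.sum_le_exp_of_nonneg (x := 4 * lam * q) (by positivity) (D + 1)
  gcongr

end OverlapMoments

/-! ### Quantiles of the overlap. -/

theorem measurable_overlap {n : ℕ} : Measurable (overlap (n := n)) := by
  unfold overlap
  fun_prop

section Quantile

/-- Negative levels carry no mass; this supplies the lower bound needed to compare infima. -/
theorem nonneg_of_mem_quantile_set {n : ℕ} {μ : Measure (Fin n → ℝ)} {D y : ℝ} (hD : 0 < D)
    (hy : 1 - Real.exp (-D) ≤ (replicas μ).real {z | |overlap z| ≤ y}) : 0 ≤ y := by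
  by_contra h
  have h0 : {z : (Fin n → ℝ) × (Fin n → ℝ) | |overlap z| ≤ y} = ∅ := by
    ext z
    simp only [Set.mem_ofPred_eq, Set.mem_empty_iff_false, iff_false, not_le]
    exact (not_le.1 h).trans_le (abs_nonneg _)
  rw [h0, measureReal_empty] at hy
  have := Real.exp_lt_exp.2 (neg_lt_zero.2 hD)
  rw [Real.exp_zero] at this
  linarith

variable {n : ℕ} {μ : Measure (Fin n → ℝ)} [IsProbabilityMeasure μ]

/-- Continuity from below provides a level, so the infimum in `quantile` is not the default value on
an empty set. -/
theorem quantile_set_nonempty (D : ℝ) :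
    {y : ℝ | 1 - Real.exp (-D) ≤ (replicas μ).real {z | |overlap z| ≤ y}}.Nonempty := by
  have hmono : Monotone fun k : ℕ => {z : (Fin n → ℝ) × (Fin n → ℝ) | |overlap z| ≤ k} := by
    intro k l hkl z hz
    exact le_trans (show |overlap z| ≤ k from hz) (Nat.cast_le.2 hkl)
  have hU : (⋃ k : ℕ, {z : (Fin n → ℝ) × (Fin n → ℝ) | |overlap z| ≤ k}) = Set.univ := by
    ext z
    simpa using exists_nat_ge |overlap z|
  have ht := tendsto_measure_iUnion_atTop (μ := replicas μ) hmono
  rw [hU, measure_univ] at ht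
  have ht' := (ENNReal.tendsto_toReal ENNReal.one_ne_top).comp ht
  have hlt : 1 - Real.exp (-D) < (1 : ℝ≥0∞).toReal := by
    have := Real.exp_pos (-D)
    simpa using this
  obtain ⟨k, hk⟩ := (ht'.eventually (lt_mem_nhds hlt)).exists
  exact ⟨k, hk.le⟩

theorem quantile_mono {D₁ D₂ : ℝ} (h₁ : 0 < D₁) (h : D₁ ≤ D₂) :
    quantile μ D₁ ≤ quantile μ D₂ := by
  refine csInf_le_csInf ⟨0, fun y hy => nonneg_of_mem_quantile_set h₁ hy⟩
    (quantile_set_nonempty D₂) fun y hy => ?_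
  refine le_trans ?_ (show 1 - Real.exp (-D₂) ≤ _ from hy)
  have := Real.exp_le_exp.2 (neg_le_neg h)
  linarith

/-- The bound is clear at each level above the infimum; continuity from below, along levels
decreasing to it, reaches the infimum itself. -/
theorem measureReal_quantile_lt_le (D : ℝ) :
    (replicas μ).real {z | quantile μ D < |overlap z|} ≤ Real.exp (-D) := by
  have hmeas : ∀ y : ℝ, MeasurableSet {z : (Fin n → ℝ) × (Fin n → ℝ) | |overlap z| ≤ y} :=
    fun y => measurableSet_le measurable_overlap.abs measurable_const
  have hcompl : ∀ y : ℝ, quantile μ D < y →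
      (replicas μ).real {z | y < |overlap z|} ≤ Real.exp (-D) := by
    intro y hy
    obtain ⟨y', hy', hlt⟩ := exists_lt_of_csInf_lt (quantile_set_nonempty D) hy
    have h1 : (replicas μ).real {z | |overlap z| ≤ y'} ≤ (replicas μ).real {z | |overlap z| ≤ y} :=
      measureReal_mono fun z hz => le_trans hz hlt.le
    have h2 : {z : (Fin n → ℝ) × (Fin n → ℝ) | y < |overlap z|} = {z | |overlap z| ≤ y}ᶜ := by
      ext z; simp
    rw [h2, probReal_compl_eq_one_sub (hmeas y)]
    have h3 : 1 - Real.exp (-D) ≤ (replicas μ).real {z | |overlap z| ≤ y'} := hy'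
    linarith
  have hmono : Monotone fun k : ℕ => {z : (Fin n → ℝ) × (Fin n → ℝ) |
      quantile μ D + 1 / ((k : ℝ) + 1) < |overlap z|} := by
    intro k l hkl z hz
    refine lt_of_le_of_lt ?_ (show quantile μ D + 1 / ((k : ℝ) + 1) < |overlap z| from hz)
    have : 1 / ((l : ℝ) + 1) ≤ 1 / ((k : ℝ) + 1) := Nat.one_div_le_one_div hkl
    linarith
  have hU : (⋃ k : ℕ, {z : (Fin n → ℝ) × (Fin n → ℝ) |
      quantile μ D + 1 / ((k : ℝ) + 1) < |overlap z|}) = {z | quantile μ D < |overlap z|} := by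
    ext z
    simp only [Set.mem_iUnion, Set.mem_ofPred_eq]
    constructor
    · rintro ⟨k, hk⟩
      have : 0 < 1 / ((k : ℝ) + 1) := Nat.one_div_pos_of_nat
      linarith
    · intro h
      obtain ⟨k, hk⟩ := exists_nat_one_div_lt (sub_pos.2 h)
      exact ⟨k, by linarith⟩
  have ht := tendsto_measure_iUnion_atTop (μ := replicas μ) hmono
  rw [hU] at ht
  have ht' := (ENNReal.tendsto_toReal (measure_ne_top _ _)).comp ht
  refine le_of_tendsto ht' (Eventually.of_forall fun k => hcompl _ ?_)
  have : 0 < 1 / ((k : ℝ) + 1) := Nat.one_div_pos_of_nat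
  linarith

end Quantile

/-! ### Sub-Weibull moments and truncation of the overlap. -/

section SubWeibull

variable {Ω : Type*} [MeasurableSpace Ω] {μ : Measure Ω} [IsProbabilityMeasure μ]

theorem IsSubWeibull.allMoments {φ K : ℝ} {Y : Ω → ℝ} (h : IsSubWeibull φ K Y μ)
    (hY : Measurable Y) : AllMoments Y μ := by
  intro p hp
  have h1 : MemLp Y (ENNReal.ofReal (max p.toReal 1)) μ :=
    ⟨hY.aestronglyMeasurable, (h _ (le_max_right _ _)).trans_lt ENNReal.ofReal_lt_top⟩
  refine h1.mono_exponent ?_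
  rw [← ENNReal.ofReal_toReal hp]
  exact ENNReal.ofReal_le_ofReal (by simp)

theorem IsSubWeibull.integral_pow_le {φ K : ℝ} (hK : 0 ≤ K) {Y : Ω → ℝ}
    (h : IsSubWeibull φ K Y μ) (hY : Measurable Y) {k : ℕ} (hk : 1 ≤ k) :
    ∫ ω, |Y ω| ^ k ∂μ ≤ (K * (k : ℝ) ^ (1 / φ)) ^ k := by
  have hk1 : (1 : ℝ) ≤ k := by exact_mod_cast hk
  have h1 := h k hk1
  have hb : 0 ≤ K * (k : ℝ) ^ (1 / φ) := by positivity
  have hm := h.allMoments hY (ENNReal.ofReal k) (by simp)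
  rw [hm.eLpNorm_eq_integral_rpow_norm (by simp; omega) (by simp),
    ENNReal.ofReal_le_ofReal_iff hb, ENNReal.toReal_ofReal (by positivity)] at h1
  simp only [Real.norm_eq_abs, Real.rpow_natCast] at h1
  have hnn : 0 ≤ ∫ ω, |Y ω| ^ k ∂μ := integral_nonneg fun _ => by positivity
  have h2 := pow_le_pow_left₀ (Real.rpow_nonneg hnn _) h1 k
  rwa [Real.rpow_inv_natCast_pow hnn (by omega)] at h2

end SubWeibull

section Tail

variable {n : ℕ} {μ : Measure (Fin n → ℝ)} [IsProbabilityMeasure μ]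

/-- The power-mean inequality over the `n` coordinates, followed by independence of the two draws.
-/
theorem integral_abs_overlap_pow_le (hn : 0 < n)
    (hX : ∀ j, AllMoments (fun x : Fin n → ℝ => x j) μ) {b : ℝ} {k : ℕ} (hk : 1 ≤ k)
    (hb : ∀ i : Fin n, ∫ x, |x i| ^ k ∂μ ≤ b ^ k) :
    ∫ z, |overlap z| ^ k ∂(replicas μ) ≤ ((n : ℝ) * b ^ 2) ^ k := by
  obtain ⟨k, rfl⟩ : ∃ l, k = l + 1 := ⟨k - 1, by omega⟩
  have hn' : (0 : ℝ) < n := by exact_mod_cast hn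
  have hpt : ∀ z : (Fin n → ℝ) × (Fin n → ℝ), |overlap z| ^ (k + 1) ≤
      (n : ℝ) ^ k * ∑ i, |z.1 i| ^ (k + 1) * |z.2 i| ^ (k + 1) := by
    intro z
    have h1 : |overlap z| ≤ ∑ i, |z.1 i * z.2 i| := Finset.abs_sum_le_sum_abs _ _
    have h2 := pow_sum_div_card_le_sum_pow (s := (Finset.univ : Finset (Fin n)))
      (f := fun i => |z.1 i * z.2 i|) (fun i _ => abs_nonneg _) k
    rw [Finset.card_univ, Fintype.card_fin, div_le_iff₀ (by positivity)] at h2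
    simp only [abs_mul, mul_pow] at h2
    refine (pow_le_pow_left₀ (abs_nonneg _) h1 _).trans ?_
    simp only [abs_mul]
    linarith
  have hi : ∀ i : Fin n, Integrable (fun z : (Fin n → ℝ) × (Fin n → ℝ) =>
      |z.1 i| ^ (k + 1) * |z.2 i| ^ (k + 1)) (replicas μ) := fun i =>
    (((allMoments_fst hX i).abs.pow _).mul ((allMoments_snd hX i).abs.pow _)).integrable
  calc ∫ z, |overlap z| ^ (k + 1) ∂(replicas μ)
      ≤ ∫ z, (n : ℝ) ^ k * ∑ i, |z.1 i| ^ (k + 1) * |z.2 i| ^ (k + 1) ∂(replicas μ) :=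
        integral_mono (((allMoments_overlap hX).abs.pow _).integrable)
          ((integrable_finsetSum _ fun i _ => hi i).const_mul _) hpt
    _ = (n : ℝ) ^ k * ∑ i : Fin n, (∫ x, |x i| ^ (k + 1) ∂μ) ^ 2 := by
        rw [integral_const_mul, integral_finsetSum _ fun i _ => hi i]
        congr 1
        exact Finset.sum_congr rfl fun i _ =>
          integral_replicas_mul_self (μ := μ) (fun x => |x i| ^ (k + 1))
    _ ≤ (n : ℝ) ^ k * ∑ _i : Fin n, (b ^ (k + 1)) ^ 2 := by
        gcongr with i
        exact hb i
    _ = ((n : ℝ) * b ^ 2) ^ (k + 1) := by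
        rw [Finset.sum_const, Finset.card_univ, Fintype.card_fin, nsmul_eq_mul, mul_pow]
        ring

/-- Splitting an absolute moment of the overlap at a level with exponentially small tail. -/
theorem integral_abs_overlap_pow_le_add (hX : ∀ j, AllMoments (fun x : Fin n → ℝ => x j) μ)
    {q T B : ℝ} (hq : 0 ≤ q) (hB : 0 < B) (k : ℕ)
    (htail : (replicas μ).real {z | q < |overlap z|} ≤ Real.exp (-T))
    (hmom : ∫ z, |overlap z| ^ (2 * k) ∂(replicas μ) ≤ B ^ (2 * k)) :
    ∫ z, |overlap z| ^ k ∂(replicas μ) ≤ q ^ k + B ^ k * Real.exp (-(T / 2)) := by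
  -- On the tail event, `x ≤ s x² / 2 + 1 / (2 s)` with `x = |overlap|^k`. This `s` balances the two
  -- contributions, each becoming at most `B^k e^{-T/2} / 2`.
  set s : ℝ := Real.exp (-(T / 2)) / B ^ k with hs
  have hspos : 0 < s := by positivity
  set E : Set ((Fin n → ℝ) × (Fin n → ℝ)) := {z | q < |overlap z|} with hE
  have hEm : MeasurableSet E := measurableSet_lt measurable_const measurable_overlap.abs
  have hpt : ∀ z : (Fin n → ℝ) × (Fin n → ℝ), |overlap z| ^ k ≤
      q ^ k + (s / 2 * |overlap z| ^ (2 * k) + E.indicator (fun _ => s⁻¹ / 2) z) := by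
    intro z
    by_cases hz : z ∈ E
    · rw [Set.indicator_of_mem hz]
      have h1 : 0 ≤ (s * |overlap z| ^ k - 1) ^ 2 := sq_nonneg _
      have h2 : |overlap z| ^ (2 * k) = (|overlap z| ^ k) ^ 2 := by rw [mul_comm, pow_mul]
      have h3 : s / 2 * |overlap z| ^ (2 * k) + s⁻¹ / 2 - |overlap z| ^ k =
          (s * |overlap z| ^ k - 1) ^ 2 * (s⁻¹ / 2) := by
        rw [h2]; field_simp; ring
      have h4 : 0 ≤ (s * |overlap z| ^ k - 1) ^ 2 * (s⁻¹ / 2) := by positivity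
      have h5 : 0 ≤ q ^ k := by positivity
      linarith
    · rw [Set.indicator_of_notMem hz]
      have h1 : |overlap z| ≤ q := not_lt.1 hz
      have h2 := pow_le_pow_left₀ (abs_nonneg _) h1 k
      have h3 : 0 ≤ s / 2 * |overlap z| ^ (2 * k) := by positivity
      linarith
  have hi1 : Integrable (fun z => |overlap z| ^ k) (replicas μ) :=
    ((allMoments_overlap hX).abs.pow k).integrable
  have hi2 : Integrable (fun z => s / 2 * |overlap z| ^ (2 * k)) (replicas μ) :=
    (((allMoments_overlap hX).abs.pow (2 * k)).const_mul _).integrable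
  have hi3 : Integrable (E.indicator fun _ => s⁻¹ / 2) (replicas μ) :=
    (integrable_const _).indicator hEm
  have hi23 : Integrable (fun z => s / 2 * |overlap z| ^ (2 * k) +
      E.indicator (fun _ => s⁻¹ / 2) z) (replicas μ) := hi2.add hi3
  have h := integral_mono hi1 ((integrable_const (q ^ k)).add hi23) hpt
  simp only [Pi.add_apply] at h
  rw [integral_add (integrable_const _) hi23, integral_add hi2 hi3, integral_const_mul,
    integral_indicator_const _ hEm] at h
  simp only [integral_const, probReal_univ, smul_eq_mul, one_mul] at h
  refine h.trans ?_
  have e1 : s / 2 * ∫ z, |overlap z| ^ (2 * k) ∂(replicas μ) ≤ s / 2 * B ^ (2 * k) := by gcongr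
  have e2 : (replicas μ).real E * (s⁻¹ / 2) ≤ Real.exp (-T) * (s⁻¹ / 2) := by gcongr
  have e3 : s / 2 * B ^ (2 * k) = B ^ k * Real.exp (-(T / 2)) / 2 := by
    rw [hs, mul_comm 2 k, pow_mul]; field_simp
  have e4 : Real.exp (-T) * (s⁻¹ / 2) = B ^ k * Real.exp (-(T / 2)) / 2 := by
    have : Real.exp (-T) = Real.exp (-(T / 2)) * Real.exp (-(T / 2)) := by
      rw [← Real.exp_add]; ring_nf
    rw [hs, this]; field_simp
  linarith

end Tail

/-! ### The Franz-Parisi potential and the overlap mass function. -/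

section FranzParisi

variable {n : ℕ} {μ : Measure (Fin n → ℝ)}

theorem annealedFP_eq (lam : ℝ) {t : ℝ} (ht : t ∈ overlapSupport μ) :
    annealedFP μ lam t = -(lam * t) - Real.log (overlapPMF μ t) := by
  have hm : MeasurableSet {z : (Fin n → ℝ) × (Fin n → ℝ) | overlap z = t} :=
    measurableSet_eq_fun measurable_overlap measurable_const
  have h1 : Set.indicator {z : (Fin n → ℝ) × (Fin n → ℝ) | overlap z = t}
      (fun z => Real.exp (lam * overlap z)) =
      Set.indicator {z | overlap z = t} (fun _ => Real.exp (lam * t)) :=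
    Set.indicator_congr fun z hz => by rw [show overlap z = t from hz]
  have ht' : 0 < overlapPMF μ t := ht
  have h2 : (replicas μ).real {z | overlap z = t} = overlapPMF μ t := rfl
  rw [annealedFP, h1, integral_indicator_const _ hm, smul_eq_mul, h2,
    Real.log_mul ht'.ne' (Real.exp_pos _).ne', Real.log_exp]
  ring

/-- The tilt contributes a linear function, whose difference quotient is `-lam` for any step; hence
`lam` plus the left side is independent of `lam`. -/
theorem discreteDeriv_annealedFP (lam : ℝ) (a : ℝ → ℝ) {t : ℝ} (ha : 0 < a t)
    (ht : t ∈ overlapSupport μ) (hta : t + a t ∈ overlapSupport μ) :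
    discreteDeriv a (annealedFP μ lam) t =
      -lam - discreteDeriv a (fun s => Real.log (overlapPMF μ s)) t := by
  simp only [discreteDeriv]
  rw [annealedFP_eq lam ht, annealedFP_eq lam hta]
  field_simp
  ring

end FranzParisi

/-! ### Assembly of the bounds. -/

/-- The non-asymptotic form of the low-degree bound: at signal-to-noise ratio at most
`1 / (q log n)`, the squared correlation is at most `2 q`, for a quantile `q` of the overlap. -/
theorem corr_sq_le_two_mul_quantile {n D : ℕ} {μ : Measure (Fin n → ℝ)} [IsProbabilityMeasure μ]
    {φ K C c lam T : ℝ} (hφ : 0 < φ) (hK : 0 < K) (hD : 0 < D) (hDC : (D : ℝ) ≤ (n : ℝ) ^ C)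
    (hL : 16 ≤ Real.log n) (hLc : 4 + 8 * (2 + C * (2 / φ) + c) ≤ Real.log n)
    (hKn : K ^ 2 * (4 : ℝ) ^ (2 / φ) ≤ n)
    (hW : ∀ i : Fin n, IsSubWeibull φ K (fun x : Fin n → ℝ => x i) μ)
    (hκ : ∀ α : Fin n → ℕ, ∑ i, α i ≤ D → 0 ≤ cumulant μ α)
    (hT : (D : ℝ) * Real.log n ^ 2 / 2 ≤ T) (hq : (n : ℝ) ^ (-c) ≤ quantile μ T)
    (hlam : 0 ≤ lam) (hlq : lam * quantile μ T ≤ 1 / Real.log n) :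
    corr μ D lam ^ 2 ≤ 2 * quantile μ T := by
  have hX : ∀ j, AllMoments (fun x : Fin n → ℝ => x j) μ := fun j =>
    (hW j).allMoments (measurable_pi_apply j)
  set q := quantile μ T with hqdef
  set L := Real.log n with hLdef
  have hn : 0 < n := by
    rcases Nat.eq_zero_or_pos n with h | h
    · rw [hLdef, h] at hL; norm_num at hL
    · exact h
  have hn' : (0 : ℝ) < n := by exact_mod_cast hn
  have hD1 : (1 : ℝ) ≤ D := by exact_mod_cast hD
  have hpow : ∀ x : ℝ, (n : ℝ) ^ x = Real.exp (L * x) := fun x => Real.rpow_def_of_pos hn' x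
  have hqpos : 0 < q := (Real.rpow_pos_of_pos hn' _).trans_le hq
  -- The moment bound is `n K² (2m)^(2/φ)` with `2m ≤ 4 n^C`. One power of `n` is the number of
  -- coordinates, the second absorbs `K² 4^(2/φ)`.
  set e := 2 + C * (2 / φ) with he
  set B := (n : ℝ) ^ e with hB
  have hBpos : 0 < B := Real.rpow_pos_of_pos hn' _
  have hmom : ∀ m ≤ D + 1, ∫ z, overlap z ^ m ∂(replicas μ) ≤ 11 / 10 * q ^ m := by
    intro m hm
    rcases Nat.eq_zero_or_pos m with rfl | hm0
    · simp; norm_num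
    have hm2 : ((2 * m : ℕ) : ℝ) ≤ 4 * (n : ℝ) ^ C := by
      have h1 : 2 * m ≤ 4 * D := by omega
      have h2 : ((2 * m : ℕ) : ℝ) ≤ ((4 * D : ℕ) : ℝ) := by exact_mod_cast h1
      push_cast at h2 ⊢
      linarith
    have hb : ∀ i : Fin n, ∫ x, |x i| ^ (2 * m) ∂μ ≤
        (K * ((2 * m : ℕ) : ℝ) ^ (1 / φ)) ^ (2 * m) := fun i =>
      (hW i).integral_pow_le hK.le (measurable_pi_apply i) (by omega)
    have hbB : (n : ℝ) * (K * ((2 * m : ℕ) : ℝ) ^ (1 / φ)) ^ 2 ≤ B := by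
      have h1 : (((2 * m : ℕ) : ℝ) ^ (1 / φ)) ^ 2 = ((2 * m : ℕ) : ℝ) ^ (2 / φ) := by
        rw [← Real.rpow_natCast, ← Real.rpow_mul (Nat.cast_nonneg _)]
        congr 1; push_cast; ring
      have h2 : ((2 * m : ℕ) : ℝ) ^ (2 / φ) ≤ (4 * (n : ℝ) ^ C) ^ (2 / φ) :=
        Real.rpow_le_rpow (Nat.cast_nonneg _) hm2 (by positivity)
      have h3 : (4 * (n : ℝ) ^ C) ^ (2 / φ) = 4 ^ (2 / φ) * (n : ℝ) ^ (C * (2 / φ)) := by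
        rw [Real.mul_rpow (by norm_num) (Real.rpow_nonneg hn'.le _), ← Real.rpow_mul hn'.le]
      have h4 : B = (n : ℝ) * n * (n : ℝ) ^ (C * (2 / φ)) := by
        rw [hB, he, Real.rpow_add hn', Real.rpow_two, sq]
      rw [mul_pow, h1, h4]
      calc (n : ℝ) * (K ^ 2 * ((2 * m : ℕ) : ℝ) ^ (2 / φ))
          ≤ n * (K ^ 2 * (4 ^ (2 / φ) * (n : ℝ) ^ (C * (2 / φ)))) := by
            rw [← h3]; gcongr
        _ = n * (K ^ 2 * 4 ^ (2 / φ)) * (n : ℝ) ^ (C * (2 / φ)) := by ring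
        _ ≤ _ := by gcongr
    have h2m : ∫ z, |overlap z| ^ (2 * m) ∂(replicas μ) ≤ B ^ (2 * m) :=
      (integral_abs_overlap_pow_le hn hX (by omega) hb).trans
        (pow_le_pow_left₀ (by positivity) hbB _)
    have hsplit := integral_abs_overlap_pow_le_add hX hqpos.le hBpos m
      (measureReal_quantile_lt_le (μ := μ) T) h2m
    have hsmall : B ^ m * Real.exp (-(T / 2)) ≤ 1 / 10 * q ^ m := by
      have hqm : Real.exp (-(L * c) * m) ≤ q ^ m := by
        rw [mul_comm, Real.exp_nat_mul]
        refine pow_le_pow_left₀ (Real.exp_pos _).le (le_trans (le_of_eq ?_) hq) m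
        rw [hpow]; ring_nf
      have hBm : B ^ m = Real.exp (L * e * m) := by
        rw [mul_comm (L * e), Real.exp_nat_mul, hB, hpow]
      -- With `e + c ≤ (L - 4)/8` and `m ≤ 2D`, the term `L (e + c) m` is at most `D L²/4 - D L`;
      -- the first part is absorbed by `T/2 ≥ D L²/4`, leaving `-D L ≤ -L`.
      have hexp : L * e * m + -(T / 2) ≤ -L + -(L * c) * m := by
        have hm' : (m : ℝ) ≤ 2 * D := by
          have : m ≤ 2 * D := by omega
          exact_mod_cast this
        have hm1 : (1 : ℝ) ≤ m := by exact_mod_cast hm0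
        have h1 : L * ((e + c) * m) ≤ L * ((L - 4) / 8 * m) := by
          gcongr
          linarith
        have h2 : (L - 4) / 8 * m ≤ (L - 4) / 8 * (2 * D) :=
          mul_le_mul_of_nonneg_left hm' (by linarith)
        have h3 : L * ((L - 4) / 8 * m) ≤ L * ((L - 4) / 8 * (2 * D)) :=
          mul_le_mul_of_nonneg_left h2 (by linarith)
        have h4 : L * 1 ≤ L * D := mul_le_mul_of_nonneg_left hD1 (by linarith)
        nlinarith
      have hL10 : Real.exp (-L) ≤ 1 / 10 := by
        rw [Real.exp_neg, inv_eq_one_div]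
        have := Real.add_one_le_exp L
        exact one_div_le_one_div_of_le (by norm_num) (by linarith)
      calc B ^ m * Real.exp (-(T / 2)) = Real.exp (L * e * m + -(T / 2)) := by
            rw [hBm, Real.exp_add]
        _ ≤ Real.exp (-L + -(L * c) * m) := Real.exp_le_exp.2 hexp
        _ = Real.exp (-L) * Real.exp (-(L * c) * m) := Real.exp_add _ _
        _ ≤ _ := by gcongr
    have habs : ∫ z, overlap z ^ m ∂(replicas μ) ≤ ∫ z, |overlap z| ^ m ∂(replicas μ) := by
      refine integral_mono ((allMoments_overlap hX).pow m).integrable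
        ((allMoments_overlap hX).abs.pow m).integrable fun z => ?_
      simp only [← abs_pow]
      exact le_abs_self _
    linarith
  have hmain := corr_sq_le_of_overlap_moments hX hκ hqpos.le (by norm_num) hlam hmom
  have h4 : 4 * lam * q ≤ 1 / 4 := by
    have : 1 / L ≤ 1 / 16 := one_div_le_one_div_of_le (by norm_num) hL
    linarith
  have hexp : Real.exp (4 * lam * q) ≤ 4 / 3 := by
    refine (Real.exp_le_exp.2 h4).trans ?_
    have h1 := Real.one_sub_le_exp_neg (1 / 4)
    rw [Real.exp_neg] at h1
    have h2 := Real.exp_pos (1 / 4 : ℝ)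
    rw [show (4 : ℝ) / 3 = (3 / 4)⁻¹ by norm_num, ← inv_inv (Real.exp (1 / 4))]
    exact inv_anti₀ (by norm_num) (by linarith)
  refine hmain.trans ?_
  -- Numerically `1.21 · 4/3 < 2`.
  calc (11 / 10 : ℝ) ^ 2 * q * Real.exp (4 * lam * q) ≤ (11 / 10 : ℝ) ^ 2 * q * (4 / 3) := by gcongr
    _ ≤ 2 * q := by nlinarith

/-- The low-degree bound along a sequence of priors, in terms of the signal-to-noise ratio. -/
theorem CumulantNonneg.eventually_corr_sq_le {P : (n : ℕ) → PMF (Fin n → ℝ)} {D D' : ℕ → ℕ}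
    {A : ℕ → ℝ} {a : ℕ → ℝ → ℝ} {C : ℝ} (hP : CumulantNonneg P D A a C)
    (hD'_pos : ∀ n, 0 < D' n)
    (hD' : (fun n : ℕ => (D' n : ℝ)) ~[atTop] (fun n : ℕ => (D n : ℝ) * Real.log n ^ 2))
    (hqD' : ∃ C₂ : ℝ, 0 < C₂ ∧ ∀ᶠ n : ℕ in atTop,
      (n : ℝ) ^ (-C₂) ≤ quantile (P n).toMeasure (D' n)) :
    ∀ᶠ n : ℕ in atTop, ∀ lam : ℝ, 0 ≤ lam →
      lam ≤ 1 / (quantile (P n).toMeasure (D n * Real.log n ^ 2) * Real.log n) →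
      corr (P n).toMeasure (D n) lam ^ 2 ≤ 2 * quantile (P n).toMeasure (D' n) := by
  obtain ⟨φ, hφ, K, hK, hW⟩ := hP.subWeibull
  obtain ⟨C₁, -, hq₁⟩ := hP.quantile_decay
  obtain ⟨C₂, -, hq₂⟩ := hqD'
  have hlog : Tendsto (fun n : ℕ => Real.log n) atTop atTop :=
    Real.tendsto_log_atTop.comp tendsto_natCast_atTop_atTop
  have hequiv := hD'.isLittleO.bound (show (0 : ℝ) < 1 / 2 by norm_num)
  filter_upwards [hP.D_le, hP.cumulant_nonneg, hW, hq₁, hq₂, hequiv,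
    hlog.eventually_ge_atTop 16,
    hlog.eventually_ge_atTop (4 + 8 * (2 + C * (2 / φ) + max C₁ C₂)),
    tendsto_natCast_atTop_atTop.eventually_ge_atTop (K ^ 2 * (4 : ℝ) ^ (2 / φ))]
    with n hDC hκ hW hq₁ hq₂ hequiv hL hLc hKn lam hlam hle
  have hDpos : (0 : ℝ) < D n := by exact_mod_cast hP.D_pos n
  have hD'pos : (0 : ℝ) < D' n := by exact_mod_cast hD'_pos n
  have hS : 0 < (D n : ℝ) * Real.log n ^ 2 := by positivity
  have hlow : (D n : ℝ) * Real.log n ^ 2 / 2 ≤ D' n := by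
    simp only [Pi.sub_apply, Real.norm_eq_abs, abs_of_pos hS] at hequiv
    have := (abs_le.1 hequiv).1
    linarith
  have hn1 : (1 : ℝ) ≤ n := by
    rcases Nat.eq_zero_or_pos n with h | h
    · rw [h] at hL; norm_num at hL
    · exact_mod_cast h
  -- The admissible `lam` is expressed through `q(D (log n)²)` and the conclusion through `q(D')`,
  -- with no order known between them. By monotonicity `q(T)` is below both, and `T` is still at
  -- least `D (log n)² / 2`.
  set T := min (D' n : ℝ) ((D n : ℝ) * Real.log n ^ 2) with hT
  have hTpos : 0 < T := lt_min hD'pos hS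
  have hqT : (n : ℝ) ^ (-max C₁ C₂) ≤ quantile (P n).toMeasure T := by
    rcases min_choice (D' n : ℝ) ((D n : ℝ) * Real.log n ^ 2) with h | h
    · rw [hT, h]
      exact (Real.rpow_le_rpow_of_exponent_le hn1 (neg_le_neg (le_max_right _ _))).trans hq₂
    · rw [hT, h]
      exact (Real.rpow_le_rpow_of_exponent_le hn1 (neg_le_neg (le_max_left _ _))).trans
        ((le_max_right _ _).trans hq₁)
  have hqS : quantile (P n).toMeasure T ≤
      quantile (P n).toMeasure (D n * Real.log n ^ 2) := quantile_mono hTpos (min_le_right _ _)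
  have hqpos : 0 < quantile (P n).toMeasure T :=
    (Real.rpow_pos_of_pos (by linarith) _).trans_le hqT
  have hqSpos := hqpos.trans_le hqS
  have hlq : lam * quantile (P n).toMeasure T ≤ 1 / Real.log n := by
    calc lam * quantile (P n).toMeasure T
        ≤ 1 / (quantile (P n).toMeasure (D n * Real.log n ^ 2) * Real.log n) *
          quantile (P n).toMeasure (D n * Real.log n ^ 2) := by gcongr
      _ = 1 / Real.log n := by
          have : Real.log n ≠ 0 := by linarith
          field_simp
  refine (corr_sq_le_two_mul_quantile hφ hK (hP.D_pos n) hDC hL hLc hKn hW hκ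
    (le_min hlow (by linarith)) hqT hlam hlq).trans ?_
  have := quantile_mono (μ := (P n).toMeasure) hTpos (min_le_left _ _)
  linarith

/-- Quantile stability turns the difference quotient of the overlap distribution into an admissible
signal-to-noise ratio. -/
theorem CumulantNonneg.eventually_neg_discreteDeriv_le {P : (n : ℕ) → PMF (Fin n → ℝ)}
    {D : ℕ → ℕ} {A : ℕ → ℝ} {a : ℕ → ℝ → ℝ} {C : ℝ} (hP : CumulantNonneg P D A a C) :
    ∀ᶠ n : ℕ in atTop, ∀ lam : ℝ, 1 / A n * (lam + discreteDeriv (a n)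
        (annealedFP (P n).toMeasure lam) (quantile (P n).toMeasure (D n))) ≤
      1 / (quantile (P n).toMeasure (D n * Real.log n ^ 2) * Real.log n) := by
  filter_upwards [hP.step, hP.quantile_stability] with n hstep hstab lam
  have hA := hP.A_pos n
  rw [discreteDeriv_annealedFP lam (a n) hstep.2.1 hstep.1 hstep.2.2, div_mul_eq_mul_div, one_mul,
    div_le_iff₀ hA, div_mul_eq_mul_div, one_mul]
  linarith

end

end GAM

theorem theorem2p8
    (P : (n : ℕ) → PMF (Fin n → ℝ)) (D D' : ℕ → ℕ) (A : ℕ → ℝ) (a : ℕ → ℝ → ℝ) (C : ℝ)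
    (hP : GAM.CumulantNonneg P D A a C)
    (hD'_pos : ∀ n, 0 < D' n)
    (hD' : (fun n : ℕ => (D' n : ℝ)) ~[atTop] (fun n : ℕ => (D n : ℝ) * Real.log n ^ 2))
    (hqD' : ∃ C₂ : ℝ, 0 < C₂ ∧ ∀ᶠ n : ℕ in atTop,
      (n : ℝ) ^ (-C₂) ≤ GAM.quantile (P n).toMeasure (D' n)) :
    (∀ᶠ n : ℕ in atTop, ∀ u : ℝ, 0 < u →
      0 < u + GAM.discreteDeriv (a n) (GAM.annealedFP (P n).toMeasure u)
        (GAM.quantile (P n).toMeasure (D n)) →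
      GAM.corr (P n).toMeasure (D n)
        (1 / A n * (u + GAM.discreteDeriv (a n) (GAM.annealedFP (P n).toMeasure u)
          (GAM.quantile (P n).toMeasure (D n)))) ^ 2
        ≤ 2 * GAM.quantile (P n).toMeasure (D' n)) ∧
    (∀ᶠ n : ℕ in atTop, ∀ lam : ℝ, 0 < lam →
      0 ≤ GAM.discreteDeriv (a n) (GAM.annealedFP (P n).toMeasure lam)
        (GAM.quantile (P n).toMeasure (D n)) →
      GAM.corr (P n).toMeasure (D n) (1 / A n * lam) ^ 2
        ≤ 2 * GAM.quantile (P n).toMeasure (D' n)) := by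
  have hcorr := hP.eventually_corr_sq_le hD'_pos hD' hqD'
  have hsnr := hP.eventually_neg_discreteDeriv_le
  constructor
  · filter_upwards [hcorr, hsnr] with n hcorr hsnr u _ hpos
    have hA := hP.A_pos n
    exact hcorr _ (by positivity) (hsnr u)
  · filter_upwards [hcorr, hsnr] with n hcorr hsnr lam hlam hpos
    have hA := hP.A_pos n
    -- A nonnegative difference quotient gives `lam ≤ lam + Δ F`, so `lam / A n` is admissible too.
    refine hcorr _ (by positivity) (le_trans ?_ (hsnr lam))
    gcongr
    linarith
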